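/- Let $M$ be a connected (Hausdorff, second countable, finite-dimensional) smooth manifold with a smooth Lorentzian metric $g$. Let $\mathfrak k$ be the Lie algebra of smooth Killing vector fields of $(M,g)$, with radical $\mathfrak r$ (so $\mathfrak k=\mathfrak s\ltimes\mathfrak r$ is its Levi decomposition), and let $\mathfrak g$ be a Lie algebra of smooth vector fields on $M$ that contains $\mathfrak k$ as an ideal. Put $\mathfrak r_0=\mathfrak r$, $\mathfrak r_i=[\mathfrak r_{i-1},\mathfrak r_{i-1}]$, let $\mathfrak z(\mathfrak r_i)$ be the center of $\mathfrak r_i$, and let $$\mathfrak a(\mathfrak r)=\sum_i\mathfrak z(\mathfrak r_i)=\langle K_1,\dots,K_r\rangle,$$ where $K_1,\dots,K_r$ is a basis. A Killing horizon is an (injectively immersed) hypersurface $\mathcal H\subset M$ that is null, i.e. $g|_{T_a\mathcal H}$ is degenerate for all $a\in\mathcal H$, and for which there is $K\in\mathfrak k$ with $K_a\in T_a\mathcal H\setminus\{0\}$ and $g(K_a,K_a)=0$ for all $a\in\mathcal H$; it is $\mathfrak k$-invariant if $X_a\in T_a\mathcal H$ for all $X\in\mathfrak k$ and $a\in\mathcal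 H$. Let $\pi\colon J^0\pi=S^2_{\mathrm{Lor}}T^*M\to M$ be the bundle of symmetric bilinear forms of Lorentzian signature, $h$ the horizontal symmetric 2-form on $J^0\pi$ given by $h_\theta(v,w)=\theta(d\pi\,v,d\pi\,w)$, and, for a vector field $X$ on $M$, let $X^{(0)}$ be its prolongation, the unique vector field on $J^0\pi$ that projects to $X$ and satisfies $L_{X^{(0)}}h=0$. For a symmetric bilinear form $B$ write $\|v_1\wedge\dots\wedge v_r\|_B^2=\det(B(v_i,v_j))$ for the induced form on $r$-vectors, and set $$R_g=\|K_1\wedge\dots\wedge K_r\|_g^2\in C^\infty(M),\qquad R^{\mathfrak a(\mathfrak r)}=\|K_1^{(0)}\wedge\dots\wedge K_r^{(0)}\|_h^2\in C^\infty(J^0\pi).$$ Then: 1. $\mathfrak a(\mathfrak r)$ is abelian, and it is an ideal of $\mathfrak g$. 2. If $\mathcal H$ is a $\mathfrak k$-invariant Killing horizon, then $R_g$ vanishes on $\mathcal H$. 3. $R_g$ is the restriction to $g$ of a relative invariant of $\mathfrak g$: one has $R_g=R^{\mathfrak a(\mathfrak r)}\circ g$, and there is a linear map $\lambda\colon\mathfrak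 g\to\mathbb R$ such that, for all $X\in\mathfrak g$, $L_X(K_1\wedge\dots\wedge K_r)=\lambda(X)\,K_1\wedge\dots\wedge K_r$ on $M$ and $X^{(0)}(R^{\mathfrak a(\mathfrak r)})=2\lambda(X)\,R^{\mathfrak a(\mathfrak r)}$ on $J^0\pi$. -/

import Mathlib

noncomputable section

namespace KillingHorizons

open Bundle Set VectorField
open scoped Manifold ContDiff Topology

set_option linter.unusedSectionVars false

variable (E : Type*) [NormedAddCommGroup E] [NormedSpace ℝ E] [FiniteDimensional ℝ E]
  (M : Type*) [TopologicalSpace M] [ChartedSpace E M] [IsManifold 𝓘(ℝ, E) ∞ M]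

/-- Smooth vector fields on `M`. -/
abbrev VField : Type _ :=
  ContMDiffSection 𝓘(ℝ, E) E ∞ (fun x : M => TangentSpace 𝓘(ℝ, E) x)

variable {E M}

instance : IsManifold 𝓘(ℝ, E) (minSmoothness ℝ 3) M := by
  simp only [minSmoothness_of_isRCLikeNormedField]
  exact IsManifold.of_le (n := ∞) (ENat.LEInfty.out)

theorem VField.mdiffAt (X : VField E M) (a : M) :
    MDiffAt (T% (fun x => X x)) a :=
  (X.contMDiff a).mdifferentiableAt (by simp)

theorem VField.contMDiff_mlieBracket (X Y : VField E M) :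
    CMDiff ∞ (T% (mlieBracket 𝓘(ℝ, E) (fun x => X x) (fun x => Y x))) := by
  have : IsManifold 𝓘(ℝ, E) (((⊤ : ℕ∞) : ℕ∞ω) + 1) M := by simpa using ‹IsManifold 𝓘(ℝ, E) ∞ M›
  exact ContDiff.mlieBracket_vectorField (m := ⊤) (n := ⊤) X.contMDiff Y.contMDiff (by simp)

instance : Bracket (VField E M) (VField E M) where
  bracket X Y := ⟨mlieBracket 𝓘(ℝ, E) (fun x => X x) (fun x => Y x), X.contMDiff_mlieBracket Y⟩

theorem VField.bracket_apply (X Y : VField E M) (a : M) :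
    ⁅X, Y⁆ a = mlieBracket 𝓘(ℝ, E) (fun x => X x) (fun x => Y x) a := rfl

instance : LieRing (VField E M) where
  add_lie X Y Z := by
    ext a
    exact mlieBracket_add_left (X.mdiffAt a) (Y.mdiffAt a)
  lie_add X Y Z := by
    ext a
    exact mlieBracket_add_right (Y.mdiffAt a) (Z.mdiffAt a)
  lie_self X := by
    ext a
    exact congrFun mlieBracket_self a
  leibniz_lie X Y Z := by
    ext a
    have h : ∀ X : VField E M, CMDiffAt (minSmoothness ℝ 2) (T% (fun x => X x)) a := fun X => by
      simp only [minSmoothness_of_isRCLikeNormedField]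
      exact (X.contMDiff a).of_le (ENat.LEInfty.out)
    exact leibniz_identity_mlieBracket_apply (h X) (h Y) (h Z)

instance : LieAlgebra ℝ (VField E M) where
  lie_smul c X Y := by
    ext a
    exact mlieBracket_const_smul_right (Y.mdiffAt a)


/-- The derivative `X f` of a function along a vector field is smooth. -/
theorem VField.contMDiff_deriv (X : VField E M) {f : M → ℝ} (hf : CMDiff ∞ f) :
    CMDiff ∞ (fun a => mvfderiv 𝓘(ℝ, E) f a (X a)) := by
  have h := (hf.contMDiff_tangentMap (m := ∞) (by simp)).comp X.contMDiff
  exact (contMDiff_snd_tangentBundle_modelSpace ℝ 𝓘(ℝ, ℝ)).comp h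

/-- Multiplication of a vector field by a function. -/
def VField.fsmul {f : M → ℝ} (hf : CMDiff ∞ f) (X : VField E M) : VField E M :=
  ⟨f • (fun x => X x), hf.smul_section X.contMDiff⟩

theorem VField.lie_fsmul (X Y : VField E M) {f : M → ℝ} (hf : CMDiff ∞ f) :
    ⁅X, VField.fsmul hf Y⁆ =
      VField.fsmul (X.contMDiff_deriv hf) Y + VField.fsmul hf ⁅X, Y⁆ := by
  ext a
  exact mlieBracket_smul_right ((hf a).mdifferentiableAt (by simp)) (Y.mdiffAt a)

/-- The bracket acts on functions as the commutator. -/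
theorem VField.deriv_bracket (X Y : VField E M) {f : M → ℝ} (hf : CMDiff ∞ f) (a : M) :
    mvfderiv 𝓘(ℝ, E) f a (⁅X, Y⁆ a) =
      mvfderiv 𝓘(ℝ, E) (fun b => mvfderiv 𝓘(ℝ, E) f b (Y b)) a (X a) -
        mvfderiv 𝓘(ℝ, E) (fun b => mvfderiv 𝓘(ℝ, E) f b (X b)) a (Y a) := by
  have key : ∀ Z : VField E M,
      (mvfderiv 𝓘(ℝ, E) f a (⁅X, Y⁆ a) -
      (mvfderiv 𝓘(ℝ, E) (fun b => mvfderiv 𝓘(ℝ, E) f b (Y b)) a (X a) -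
        mvfderiv 𝓘(ℝ, E) (fun b => mvfderiv 𝓘(ℝ, E) f b (X b)) a (Y a))) • Z a = 0 := by
    intro Z
    have h := congrArg (fun W : VField E M => W a) (leibniz_lie X Y (VField.fsmul hf Z))
    have h0 := congrArg (fun W : VField E M => f a • W a) (leibniz_lie X Y Z)
    simp only [VField.lie_fsmul, lie_add] at h
    change (((_ : ℝ) • Z a + (_ : ℝ) • ⁅X, Z⁆ a) + ((_ : ℝ) • ⁅Y, Z⁆ a + f a • ⁅X, ⁅Y, Z⁆⁆ a) : TangentSpace 𝓘(ℝ, E) a)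
      = ((_ : ℝ) • Z a + f a • ⁅⁅X, Y⁆, Z⁆ a) +
        (((_ : ℝ) • Z a + (_ : ℝ) • ⁅Y, Z⁆ a) + ((_ : ℝ) • ⁅X, Z⁆ a + f a • ⁅Y, ⁅X, Z⁆⁆ a)) at h
    change f a • ⁅X, ⁅Y, Z⁆⁆ a = f a • (⁅⁅X, Y⁆, Z⁆ a + ⁅Y, ⁅X, Z⁆⁆ a) at h0
    rw [h0, smul_add] at h
    rw [← neg_eq_zero, ← sub_eq_zero.2 h]
    module
  by_cases hX : X a = 0
  · by_cases hY : Y a = 0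
    · by_cases hXY : ⁅X, Y⁆ a = 0
      · simp [hX, hY, hXY]
      · exact sub_eq_zero.1 ((smul_eq_zero.1 (key _)).resolve_right hXY)
    · exact sub_eq_zero.1 ((smul_eq_zero.1 (key _)).resolve_right hY)
  · exact sub_eq_zero.1 ((smul_eq_zero.1 (key _)).resolve_right hX)


variable (E M) in
/-- The total space of the bundle `T*M ⊗ T*M` of bilinear forms on the tangent spaces of `M`. -/
abbrev BilinBundle : Type _ :=
  TotalSpace (E →L[ℝ] E →L[ℝ] ℝ)
    (fun x : M => TangentSpace 𝓘(ℝ, E) x →L[ℝ] TangentSpace 𝓘(ℝ, E) x →L[ℝ] ℝ)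

/-- The model with corners of the manifold `T*M ⊗ T*M`. -/
abbrev bilinModel (E : Type*) [NormedAddCommGroup E] [NormedSpace ℝ E] :
    ModelWithCorners ℝ (E × (E →L[ℝ] E →L[ℝ] ℝ)) (ModelProd E (E →L[ℝ] E →L[ℝ] ℝ)) :=
  (𝓘(ℝ, E)).prod 𝓘(ℝ, E →L[ℝ] E →L[ℝ] ℝ)

/-- A symmetric bilinear form of Lorentzian signature `(-, +, …, +)`: there is a timelike vector
whose orthogonal complement is positive definite. -/
def IsLorentzForm {V : Type*} [AddCommGroup V] [Module ℝ V] [TopologicalSpace V]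
    (B : V →L[ℝ] V →L[ℝ] ℝ) : Prop :=
  (∀ v w, B v w = B w v) ∧ ∃ t, B t t < 0 ∧ ∀ v, B t v = 0 → v ≠ 0 → 0 < B v v

variable (E M) in
/-- The total space `J⁰π = S²_Lor T*M`, as a subset of `T*M ⊗ T*M`. -/
def lorentzBundle : Set (BilinBundle E M) := {θ | IsLorentzForm θ.2}

variable (E M) in
/-- A smooth Lorentzian metric on `M`, i.e. a smooth section of `S²_Lor T*M → M`. -/
structure LorentzMetric where
  toFun (a : M) : TangentSpace 𝓘(ℝ, E) a →L[ℝ] TangentSpace 𝓘(ℝ, E) a →L[ℝ] ℝ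
  isLorentz (a : M) : IsLorentzForm (toFun a)
  contMDiff : ContMDiff 𝓘(ℝ, E) (bilinModel E) ∞
    (fun a => (TotalSpace.mk' (E →L[ℝ] E →L[ℝ] ℝ) a (toFun a) : BilinBundle E M))

/-- The metric as a section of `J⁰π → M`. -/
def LorentzMetric.toSection (g : LorentzMetric E M) (a : M) : BilinBundle E M :=
  ⟨a, g.toFun a⟩

/-- `X` is a Killing vector field of `g`: `L_X g = 0`. -/
def IsKilling (g : LorentzMetric E M) (X : VField E M) : Prop :=
  ∀ (Y Z : VField E M) (a : M),
    mvfderiv 𝓘(ℝ, E) (fun b => g.toFun b (Y b) (Z b)) a (X a) =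
      g.toFun a (⁅X, Y⁆ a) (Z a) + g.toFun a (Y a) (⁅X, Z⁆ a)

theorem LorentzMetric.contMDiff_apply (g : LorentzMetric E M) (Y Z : VField E M) :
    CMDiff ∞ (fun b => g.toFun b (Y b) (Z b)) := by
  have h := ContMDiff.clm_bundle_apply₂ (IB := 𝓘(ℝ, E)) (F₃ := ℝ) (E₃ := fun _ : M => ℝ)
     (b := fun x : M => x) (n := ∞) g.contMDiff Y.contMDiff Z.contMDiff
  intro a
  exact ((contMDiffAt_totalSpace).1 (h a)).2

/-- The Lie algebra of Killing vector fields of `g`. -/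
def killingAlgebra (g : LorentzMetric E M) : LieSubalgebra ℝ (VField E M) where
  carrier := {X | IsKilling g X}
  zero_mem' := by
    intro Y Z a
    simp
  add_mem' := by
    intro X X' hX hX' Y Z a
    have := hX Y Z a
    have := hX' Y Z a
    simp only [add_lie, ContMDiffSection.coe_add, Pi.add_apply, map_add,
      add_apply]
    linarith
  smul_mem' := by
    intro c X hX Y Z a
    have := hX Y Z a
    simp only [smul_lie, ContMDiffSection.coe_smul, Pi.smul_apply, map_smul,
      smul_apply, smul_eq_mul]
    rw [this]
    ring
  lie_mem' := by
    intro X X' hX hX' Y Z a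
    have hd : ∀ (U V : VField E M) (b : M), MDiffAt (fun b => g.toFun b (U b) (V b)) b :=
      fun U V b => (g.contMDiff_apply U V b).mdifferentiableAt (by simp)
    rw [VField.deriv_bracket X X' (g.contMDiff_apply Y Z) a]
    rw [show (fun b => mvfderiv 𝓘(ℝ, E) (fun b => g.toFun b (Y b) (Z b)) b (X' b)) = _ from
        funext fun b => hX' Y Z b,
      show (fun b => mvfderiv 𝓘(ℝ, E) (fun b => g.toFun b (Y b) (Z b)) b (X b)) = _ from
        funext fun b => hX Y Z b,
      mvfderiv_fun_add (hd _ _ _) (hd _ _ _), mvfderiv_fun_add (hd _ _ _) (hd _ _ _)]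
    simp only [add_apply, hX _ _ a, hX' _ _ a, lie_lie,
      ContMDiffSection.coe_sub, Pi.sub_apply, map_sub, sub_apply]
    ring

section LieAlgebra

variable {L : Type*} [LieRing L] [LieAlgebra ℝ L]

/-- The center `{x ∈ I | [x, y] = 0 for all y ∈ I}` of an ideal `I`; it is an ideal of the ambient
Lie algebra. -/
def idealCenter (I : LieIdeal ℝ L) : LieIdeal ℝ L where
  carrier := {x | x ∈ I ∧ ∀ y ∈ I, ⁅x, y⁆ = 0}
  zero_mem' := ⟨I.zero_mem, fun y _ => zero_lie y⟩
  add_mem' := fun hx hy => ⟨I.add_mem hx.1 hy.1, fun z hz => by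
    rw [add_lie, hx.2 z hz, hy.2 z hz, add_zero]⟩
  smul_mem' := fun c x hx => ⟨I.smul_mem c hx.1, fun z hz => by
    rw [smul_lie, hx.2 z hz, smul_zero]⟩
  lie_mem := fun {z x} hx => ⟨LieSubmodule.lie_mem I hx.1, fun y hy => by
    rw [lie_lie, hx.2 y hy, hx.2 _ (LieSubmodule.lie_mem I hy), lie_zero, sub_zero]⟩

variable (L) in
/-- The ideal `𝔞(𝔯) = 𝔷(𝔯₀) + 𝔷(𝔯₁) + …`, where `𝔯 = 𝔯₀ ⊇ 𝔯₁ ⊇ …` is the derived series of the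
radical `𝔯` of the Lie algebra `L`. -/
def radicalAbelianIdeal : LieIdeal ℝ L :=
  ⨆ i : ℕ, idealCenter (LieAlgebra.derivedSeriesOfIdeal ℝ L i (LieAlgebra.radical ℝ L))

end LieAlgebra

/-- The bilinear form induced by `B` on the `r`-th exterior power:
`B(v₁ ∧ … ∧ v_r, w₁ ∧ … ∧ w_r) = det (B(v_i, w_j))`. -/
def exteriorForm {V : Type*} [AddCommGroup V] [Module ℝ V] (B : V →ₗ[ℝ] V →ₗ[ℝ] ℝ) (r : ℕ) :
    ⋀[ℝ]^r V →ₗ[ℝ] ⋀[ℝ]^r V →ₗ[ℝ] ℝ :=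
  exteriorPower.pairingDual ℝ V r ∘ₗ exteriorPower.map r B

/-- `‖v₁ ∧ … ∧ v_r‖²_B`. -/
def wedgeNormSq {V : Type*} [AddCommGroup V] [Module ℝ V] (B : V →ₗ[ℝ] V →ₗ[ℝ] ℝ) {r : ℕ}
    (v : Fin r → V) : ℝ :=
  exteriorForm B r (exteriorPower.ιMulti ℝ r v) (exteriorPower.ιMulti ℝ r v)

/-- The horizontal symmetric 2-form `h` on `T*M ⊗ T*M`: `h_θ(v, w) = θ(dπ v, dπ w)`. -/
def horizontalForm (θ : BilinBundle E M) :
    TangentSpace (bilinModel E) θ →ₗ[ℝ] TangentSpace (bilinModel E) θ →ₗ[ℝ] ℝ :=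
  (ContinuousLinearMap.toLinearMap₁₂ θ.2).compl₁₂
    (mfderiv (bilinModel E) 𝓘(ℝ, E) (TotalSpace.proj : BilinBundle E M → M) θ).toLinearMap
    (mfderiv (bilinModel E) 𝓘(ℝ, E) (TotalSpace.proj : BilinBundle E M → M) θ).toLinearMap

/-- The components of the vector field `Y` at `b` in the coordinates of the preferred chart at `a`;
for `b = a` this is `Y a`. -/
def VField.coord (a : M) (Y : VField E M) (b : M) : E :=
  (trivializationAt E (fun x : M => TangentSpace 𝓘(ℝ, E) x) a ⟨b, Y b⟩).2

/-- The matrix `∂ⱼ Xⁱ` of partial derivatives at `a` of the components of `X` in the preferred chart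
at `a`. -/
def VField.coordDeriv (X : VField E M) (a : M) : E →L[ℝ] E :=
  mvfderiv 𝓘(ℝ, E) (VField.coord a X) a

/-- The prolongation `X⁽⁰⁾` of a vector field `X = Xⁱ ∂ᵢ` on `M` to the bundle of bilinear forms.
In the fibre coordinates `u` of the chart at the base point of `θ` it is
`X⁽⁰⁾ = Xⁱ ∂ᵢ - (u_{kj} ∂ᵢ Xᵏ + u_{ik} ∂ⱼ Xᵏ) ∂_{u_{ij}}`. By `proj_prolong` and `lie_prolong`
below it projects to `X` and satisfies `L_{X⁽⁰⁾} h = 0`, which determines it. -/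
def prolong (X : VField E M) (θ : BilinBundle E M) : TangentSpace (bilinModel E) θ :=
  let A : E →L[ℝ] E := X.coordDeriv θ.proj
  let B : E →L[ℝ] E →L[ℝ] ℝ := θ.2
  (X θ.proj, -(B.bilinearComp A (.id ℝ E) + B.bilinearComp (.id ℝ E) A))

section Bundle
variable {F : Type*} [NormedAddCommGroup F] [NormedSpace ℝ F] {V : M → Type*}
  [TopologicalSpace (TotalSpace F V)] [∀ x, TopologicalSpace (V x)] [FiberBundle F V]

theorem hasMFDerivAt_proj (θ : TotalSpace F V) :
   HasMFDerivAt ((𝓘(ℝ, E)).prod 𝓘(ℝ, F)) 𝓘(ℝ, E) (TotalSpace.proj : TotalSpace F V → M) θ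
     (ContinuousLinearMap.fst ℝ E F) := by
  refine ⟨(FiberBundle.continuous_proj _ _).continuousAt, ?_⟩
  have h : HasFDerivWithinAt (Prod.fst : E × F → E) (ContinuousLinearMap.fst ℝ E F) (range ((𝓘(ℝ, E)).prod 𝓘(ℝ, F))) (extChartAt ((𝓘(ℝ, E)).prod 𝓘(ℝ, F)) θ θ) := hasFDerivWithinAt_fst
  have hc : ∀ η ∈ (extChartAt ((𝓘(ℝ, E)).prod 𝓘(ℝ, F)) θ).source, (extChartAt ((𝓘(ℝ, E)).prod 𝓘(ℝ, F)) θ η).1 = extChartAt 𝓘(ℝ, E) θ.proj η.proj := by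
    intro η hη
    rw [FiberBundle.extChartAt] at hη ⊢
    rw [PartialEquiv.trans_source] at hη
    exact congrArg (extChartAt 𝓘(ℝ, E) θ.proj) (Trivialization.coe_fst _ hη.1)
  refine h.congr_of_eventuallyEq ?_ ?_
  · filter_upwards [extChartAt_target_mem_nhdsWithin (I := (𝓘(ℝ, E)).prod 𝓘(ℝ, F)) θ] with z hz
    have := (extChartAt ((𝓘(ℝ, E)).prod 𝓘(ℝ, F)) θ).right_inv hz
    have h2 := (extChartAt ((𝓘(ℝ, E)).prod 𝓘(ℝ, F)) θ).map_target hz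
    have h4 := congrArg Prod.fst this
    rw [hc _ h2] at h4
    rw [← h4, ]
    simp only [writtenInExtChartAt, Function.comp]
  · have := (extChartAt ((𝓘(ℝ, E)).prod 𝓘(ℝ, F)) θ).left_inv (mem_extChartAt_source θ)
    simp only [writtenInExtChartAt, Function.comp, this]
    exact (hc _ (mem_extChartAt_source θ)).symm

theorem hasMFDerivAt_snd (θ : TotalSpace F V) :
   HasMFDerivAt ((𝓘(ℝ, E)).prod 𝓘(ℝ, F)) 𝓘(ℝ, F)
     (fun η : TotalSpace F V => (trivializationAt F V θ.proj η).2) θ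
     (ContinuousLinearMap.snd ℝ E F) := by
  refine ⟨?_, ?_⟩
  · refine continuous_snd.continuousAt.comp ?_
    exact (trivializationAt F V θ.proj).continuousAt (FiberBundle.mem_trivializationAt_proj_source)
  have h : HasFDerivWithinAt (Prod.snd : E × F → F) (ContinuousLinearMap.snd ℝ E F) (range ((𝓘(ℝ, E)).prod 𝓘(ℝ, F))) (extChartAt ((𝓘(ℝ, E)).prod 𝓘(ℝ, F)) θ θ) := hasFDerivWithinAt_snd
  refine h.congr_of_eventuallyEq ?_ ?_
  · filter_upwards [extChartAt_target_mem_nhdsWithin (I := (𝓘(ℝ, E)).prod 𝓘(ℝ, F)) θ] with z hz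
    have := (extChartAt ((𝓘(ℝ, E)).prod 𝓘(ℝ, F)) θ).right_inv hz
    exact congrArg Prod.snd this
  · have := (extChartAt ((𝓘(ℝ, E)).prod 𝓘(ℝ, F)) θ).left_inv (mem_extChartAt_source θ)
    simp only [writtenInExtChartAt, Function.comp, this]
    rfl

end Bundle

/-- `X⁽⁰⁾` projects to `X`. -/
theorem proj_prolong (X : VField E M) (θ : BilinBundle E M) :
    mfderiv (bilinModel E) 𝓘(ℝ, E) (TotalSpace.proj : BilinBundle E M → M) θ (prolong X θ) =
      X θ.proj := by
  rw [(hasMFDerivAt_proj θ).mfderiv]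
  rfl

theorem coord_eq (Y : VField E M) (a b : M) (hb : b ∈ (chartAt E a).source) : VField.coord a Y b = mfderiv 𝓘(ℝ, E) 𝓘(ℝ, E) (extChartAt 𝓘(ℝ, E) a) b (Y b) := by
  rw [← TangentBundle.continuousLinearMapAt_trivializationAt hb]
  erw [Trivialization.continuousLinearMapAt_apply, Trivialization.coe_linearMapAt_of_mem _ hb]
  rfl

theorem coord_self (Y : VField E M) (a : M) : VField.coord a Y a = Y a := by
  have : VField.coord a Y a = (tangentBundleCore 𝓘(ℝ, E) M).coordChange (achart E a) (achart E a) a (Y a) := rfl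
  rw [this]
  exact (tangentBundleCore 𝓘(ℝ, E) M).coordChange_self _ _ (mem_chart_source E a) _

theorem coord_mdiff (Y : VField E M) (a : M) : MDiffAt (VField.coord a Y) a :=
  ((contMDiffAt_totalSpace).1 (Y.contMDiff a)).2.mdifferentiableAt (by simp)

theorem bracket_coord (X Y : VField E M) (a : M) :
  ⁅X, Y⁆ a = mvfderiv 𝓘(ℝ, E) (VField.coord a Y) a (X a) - mvfderiv 𝓘(ℝ, E) (VField.coord a X) a (Y a) := by
  have key : ∀ Z : VField E M, mpullbackWithin 𝓘(ℝ, E) 𝓘(ℝ, E) (extChartAt 𝓘(ℝ, E) a).symm (fun x => Z x) (range 𝓘(ℝ, E)) =ᶠ[𝓝 (extChartAt 𝓘(ℝ, E) a a)] (VField.coord a Z ∘ (extChartAt 𝓘(ℝ, E) a).symm) := by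
    intro Z
    filter_upwards [extChartAt_target_mem_nhds (I := 𝓘(ℝ, E)) a] with y hy
    rw [mpullbackWithin_apply, Function.comp, coord_eq]
    · congr 1
      exact ContinuousLinearMap.inverse_eq (mfderivWithin_extChartAt_symm_comp_mfderiv_extChartAt hy) (mfderiv_extChartAt_comp_mfderivWithin_extChartAt_symm hy)
    · simpa using (extChartAt 𝓘(ℝ, E) a).map_target hy
  have hfd : ∀ Z : VField E M, mvfderiv 𝓘(ℝ, E) (VField.coord a Z) a = fderiv ℝ (VField.coord a Z ∘ (extChartAt 𝓘(ℝ, E) a).symm) (extChartAt 𝓘(ℝ, E) a a) := by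
    intro Z
    have := (coord_mdiff Z a).mvfderiv
    rw [this]
    simp only [modelWithCornersSelf_coe, range_id, fderivWithin_univ]
    rfl
  have hid : mfderiv 𝓘(ℝ, E) 𝓘(ℝ, E) (extChartAt 𝓘(ℝ, E) a) a = ContinuousLinearMap.id ℝ E := by
    ext v
    rw [← TangentBundle.continuousLinearMapAt_trivializationAt (mem_chart_source E a)]
    rw [TangentBundle.continuousLinearMapAt_trivializationAt_eq_core (mem_chart_source E a)]
    exact (tangentBundleCore 𝓘(ℝ, E) M).coordChange_self _ _ (mem_chart_source E a) _
  rw [VField.bracket_apply, ← mlieBracketWithin_univ, mlieBracketWithin_apply]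
  rw [hfd, hfd]
  let W : VField E M → E → E := fun Z =>
    mpullbackWithin 𝓘(ℝ, E) 𝓘(ℝ, E) (extChartAt 𝓘(ℝ, E) a).symm (fun x => Z x) (range 𝓘(ℝ, E))
  let P : E →L[ℝ] E := mfderiv 𝓘(ℝ, E) 𝓘(ℝ, E) (extChartAt 𝓘(ℝ, E) a) a
  have hP : P = ContinuousLinearMap.id ℝ E := hid
  have hset : ((extChartAt 𝓘(ℝ, E) a).symm ⁻¹' univ ∩ range 𝓘(ℝ, E)) = univ := by simp
  have e : lieBracketWithin ℝ (W X) (W Y) ((extChartAt 𝓘(ℝ, E) a).symm ⁻¹' univ ∩ range 𝓘(ℝ, E))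
      (extChartAt 𝓘(ℝ, E) a a) =
      lieBracket ℝ (VField.coord a X ∘ (extChartAt 𝓘(ℝ, E) a).symm)
        (VField.coord a Y ∘ (extChartAt 𝓘(ℝ, E) a).symm) (extChartAt 𝓘(ℝ, E) a a) := by
    rw [hset, lieBracketWithin_univ]
    exact Filter.EventuallyEq.lieBracket_vectorField_eq (𝕜 := ℝ) (key X) (key Y)
  change P.inverse (lieBracketWithin ℝ (W X) (W Y)
    ((extChartAt 𝓘(ℝ, E) a).symm ⁻¹' univ ∩ range 𝓘(ℝ, E)) (extChartAt 𝓘(ℝ, E) a a)) = _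
  rw [e, hP, ContinuousLinearMap.inverse_id]
  simp only [lieBracket, Function.comp, extChartAt_to_inv, coord_self]
  rfl

theorem eval_eq (Y Z : VField E M) (θ η : BilinBundle E M) (h : η.proj ∈ (chartAt E θ.proj).source) :
   η.2 (Y η.proj) (Z η.proj) =
   ((trivializationAt (E →L[ℝ] E →L[ℝ] ℝ) (fun x : M => TangentSpace 𝓘(ℝ, E) x →L[ℝ] TangentSpace 𝓘(ℝ, E) x →L[ℝ] ℝ) θ.proj) η).2 (VField.coord θ.proj Y η.proj) (VField.coord θ.proj Z η.proj) := by
  have hs : ∀ W : VField E M, (trivializationAt E (fun x : M => TangentSpace 𝓘(ℝ, E) x) θ.proj).symm η.proj (VField.coord θ.proj W η.proj) = W η.proj := by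
    intro W
    exact (trivializationAt E (fun x : M => TangentSpace 𝓘(ℝ, E) x) θ.proj).symm_apply_apply_mk  (b := η.proj) h (W η.proj)
  rw [hom_trivializationAt_apply]
  have := inCoordinates_apply_eq₂ (𝕜 := ℝ) (F₁ := E) (F₂ := E) (F₃ := ℝ) (E₁ := fun x : M => TangentSpace 𝓘(ℝ, E) x) (E₂ := fun x : M => TangentSpace 𝓘(ℝ, E) x) (E₃ := fun x : M => ℝ) (x₀ := θ.proj) (x := η.proj) (ϕ := η.2) (v := VField.coord θ.proj Y η.proj) (w := VField.coord θ.proj Z η.proj) h h (by simp)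
  refine Eq.trans ?_ this.symm
  rw [hs, hs]
  simp

theorem hasMFDerivAt_clm2 {EN HN N G : Type*} [NormedAddCommGroup EN] [NormedSpace ℝ EN] [NormedAddCommGroup G] [NormedSpace ℝ G] [TopologicalSpace HN]
  {I : ModelWithCorners ℝ EN HN} [TopologicalSpace N] [ChartedSpace HN N] {p : N → G →L[ℝ] G →L[ℝ] ℝ} {y z : N → G} {x : N}
  {p' : EN →L[ℝ] (G →L[ℝ] G →L[ℝ] ℝ)} {y' z' : EN →L[ℝ] G}
  (hp : HasMFDerivAt I 𝓘(ℝ, G →L[ℝ] G →L[ℝ] ℝ) p x p') (hy : HasMFDerivAt I 𝓘(ℝ, G) y x y') (hz : HasMFDerivAt I 𝓘(ℝ, G) z x z') :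
  ∃ D : EN →L[ℝ] ℝ, HasMFDerivAt I 𝓘(ℝ, ℝ) (fun η => p η (y η) (z η)) x D ∧ ∀ v, D v = p' v (y x) (z x) + p x (y' v) (z x) + p x (y x) (z' v) := by
  refine ⟨_, ⟨(hp.1.clm_apply hy.1).clm_apply hz.1, HasFDerivWithinAt.clm_apply (HasFDerivWithinAt.clm_apply hp.2 hy.2) hz.2⟩, ?_⟩
  intro v
  simp
  ring

/-- `L_{X⁽⁰⁾} h = 0`, evaluated on the lifts of two vector fields `Y`, `Z` on `M`. -/
theorem lie_prolong (X Y Z : VField E M) (θ : BilinBundle E M) :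
   mvfderiv (bilinModel E) (fun η : BilinBundle E M => η.2 (Y η.proj) (Z η.proj)) θ (prolong X θ)
    = θ.2 (⁅X, Y⁆ θ.proj) (Z θ.proj) + θ.2 (Y θ.proj) (⁅X, Z⁆ θ.proj) := by
  have e : (fun η : BilinBundle E M => η.2 (Y η.proj) (Z η.proj)) =ᶠ[𝓝 θ] fun η => ((trivializationAt (E →L[ℝ] E →L[ℝ] ℝ) (fun x : M => TangentSpace 𝓘(ℝ, E) x →L[ℝ] TangentSpace 𝓘(ℝ, E) x →L[ℝ] ℝ) θ.proj) η).2 (VField.coord θ.proj Y η.proj) (VField.coord θ.proj Z η.proj) := by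
    have : (TotalSpace.proj : BilinBundle E M → M) ⁻¹' (chartAt E θ.proj).source ∈ 𝓝 θ :=
      (FiberBundle.continuous_proj _ _).continuousAt.preimage_mem_nhds (chart_source_mem_nhds E _)
    filter_upwards [this] with η hη
    exact eval_eq Y Z θ η hη
  have hY := (coord_mdiff Y θ.proj).hasMFDerivAt.comp θ (hasMFDerivAt_proj (E := E) θ)
  have hZ := (coord_mdiff Z θ.proj).hasMFDerivAt.comp θ (hasMFDerivAt_proj (E := E) θ)
  have hs := hasMFDerivAt_snd (E := E) θ
  have key := hasMFDerivAt_clm2 hs hY hZ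
  obtain ⟨D, key, hD⟩ := key
  have e2 := key.congr_of_eventuallyEq e
  have e3 := e2.mfderiv
  have e4 : mvfderiv (bilinModel E) (fun η : BilinBundle E M => η.2 (Y η.proj) (Z η.proj)) θ (prolong X θ) = mfderiv (bilinModel E) 𝓘(ℝ, ℝ) (fun η : BilinBundle E M => η.2 (Y η.proj) (Z η.proj)) θ (prolong X θ) := rfl
  rw [e4, e3, bracket_coord, bracket_coord]
  refine (hD (prolong X θ)).trans ?_
  have h1 : ∀ v w : E, ((trivializationAt (E →L[ℝ] E →L[ℝ] ℝ) (fun x : M => TangentSpace 𝓘(ℝ, E) x →L[ℝ] TangentSpace 𝓘(ℝ, E) x →L[ℝ] ℝ) θ.proj) θ).2 v w = (θ.2 : E →L[ℝ] E →L[ℝ] ℝ) v w := by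
    intro v w
    have hm : θ.proj ∈ (chartAt E θ.proj).source := mem_chart_source E _
    have hs : ∀ W : E, (trivializationAt E (fun x : M => TangentSpace 𝓘(ℝ, E) x) θ.proj).symm θ.proj W = W := by
      intro W
      have h0 : (trivializationAt E (fun x : M => TangentSpace 𝓘(ℝ, E) x) θ.proj ⟨θ.proj, W⟩).2 = W := 
        (tangentBundleCore 𝓘(ℝ, E) M).coordChange_self _ _ (mem_chart_source E _) _
      have h5 := (trivializationAt E (fun x : M => TangentSpace 𝓘(ℝ, E) x) θ.proj).symm_apply_apply_mk  (b := θ.proj) hm W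
      rw [h0] at h5
      exact h5
    rw [hom_trivializationAt_apply]
    have := inCoordinates_apply_eq₂ (𝕜 := ℝ) (F₁ := E) (F₂ := E) (F₃ := ℝ) (E₁ := fun x : M => TangentSpace 𝓘(ℝ, E) x) (E₂ := fun x : M => TangentSpace 𝓘(ℝ, E) x) (E₃ := fun x : M => ℝ) (x₀ := θ.proj) (x := θ.proj) (ϕ := θ.2) (v := v) (w := w) hm hm (by simp)
    refine this.trans ?_
    rw [hs, hs]
    simp
  rw [h1, h1]
  simp only [Function.comp, coord_self]
  let B : E →L[ℝ] E →L[ℝ] ℝ := θ.2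
  let A : E →L[ℝ] E := X.coordDeriv θ.proj
  let y : E := Y θ.proj
  let z : E := Z θ.proj
  let x : E := X θ.proj
  let DY : E →L[ℝ] E := mvfderiv 𝓘(ℝ, E) (VField.coord θ.proj Y) θ.proj
  let DZ : E →L[ℝ] E := mvfderiv 𝓘(ℝ, E) (VField.coord θ.proj Z) θ.proj
  change (-(B.bilinearComp A (.id ℝ E) + B.bilinearComp (.id ℝ E) A)) y z + B (DY x) z + B y (DZ x)
    = B (DY x - A y) z + B y (DZ x - A z)
  simp
  ring

/-- `R_g = ‖K₁ ∧ … ∧ K_r‖²_g`, a function on `M`. -/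
def metricWedgeNormSq (g : LorentzMetric E M) {r : ℕ} (K : Fin r → VField E M) (a : M) : ℝ :=
  wedgeNormSq (ContinuousLinearMap.toLinearMap₁₂ (g.toFun a)) (fun i => K i a)

/-- `R = ‖K₁⁽⁰⁾ ∧ … ∧ K_r⁽⁰⁾‖²_h`, a function on the bundle of bilinear forms. -/
def wedgeInvariant {r : ℕ} (K : Fin r → VField E M) (θ : BilinBundle E M) : ℝ :=
  wedgeNormSq (horizontalForm θ) (fun i => prolong (K i) θ)

/-- The `r`-vector `K₁ ∧ … ∧ K_r` at `a`. -/
def wedgeAt {r : ℕ} (K : Fin r → VField E M) (a : M) : ⋀[ℝ]^r (TangentSpace 𝓘(ℝ, E) a) :=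
  exteriorPower.ιMulti ℝ r (fun i => K i a)

/-- The Lie derivative `L_X (K₁ ∧ … ∧ K_r) = ∑ᵢ K₁ ∧ … ∧ [X, Kᵢ] ∧ … ∧ K_r` at `a`. -/
def lieWedgeAt {r : ℕ} (X : VField E M) (K : Fin r → VField E M) (a : M) :
    ⋀[ℝ]^r (TangentSpace 𝓘(ℝ, E) a) :=
  ∑ i, wedgeAt (Function.update K i ⁅X, K i⁆) a

/-- `R` is a relative invariant of order `0` on the set `S ⊆ J⁰π`, with respect to the Lie algebra
`𝔤` of vector fields and with weight `w ∈ 𝔤*`: it is smooth and `X⁽⁰⁾(R) = w(X) R` at all points of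
`S`, for all `X ∈ 𝔤`. -/
def IsRelativeInvariantOn (𝔤 : LieSubalgebra ℝ (VField E M)) (S : Set (BilinBundle E M))
    (R : BilinBundle E M → ℝ) (w : 𝔤 →ₗ[ℝ] ℝ) : Prop :=
  ∀ θ ∈ S, ContMDiffAt (bilinModel E) 𝓘(ℝ, ℝ) ∞ R θ ∧
    ∀ X : 𝔤, mvfderiv (bilinModel E) R θ (prolong (X : VField E M) θ) = w X * R θ

section Horizon

variable {E' : Type*} [NormedAddCommGroup E'] [NormedSpace ℝ E']
  {N : Type*} [TopologicalSpace N] [ChartedSpace E' N]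

/-- `ι : N → M` is an injectively immersed hypersurface. -/
structure IsHypersurface (ι : N → M) : Prop where
  finrank_eq : Module.finrank ℝ E' + 1 = Module.finrank ℝ E
  contMDiff : ContMDiff 𝓘(ℝ, E') 𝓘(ℝ, E) ∞ ι
  injective : Function.Injective ι
  injective_mfderiv : ∀ p, Function.Injective (mfderiv 𝓘(ℝ, E') 𝓘(ℝ, E) ι p)

/-- The tangent space `T_{ι p} H ⊆ T_{ι p} M` of the hypersurface `H = ι(N)`. -/
def hypersurfaceTangent (ι : N → M) (p : N) : Submodule ℝ (TangentSpace 𝓘(ℝ, E) (ι p)) :=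
  (mfderiv 𝓘(ℝ, E') 𝓘(ℝ, E) ι p).range

/-- `H = ι(N)` is a Killing horizon of `g`: a null hypersurface (the metric induced on each of its
tangent spaces is degenerate) together with a Killing vector field that is null, tangent to `H` and
nowhere zero along `H`. -/
structure IsKillingHorizon (g : LorentzMetric E M) (ι : N → M) : Prop where
  isHypersurface : IsHypersurface (E := E) (E' := E') ι
  isNull : ∀ p, ∃ n ∈ hypersurfaceTangent (E := E) (E' := E') ι p, n ≠ 0 ∧
    ∀ v ∈ hypersurfaceTangent (E := E) (E' := E') ι p, g.toFun (ι p) n v = 0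
  exists_generator : ∃ K ∈ killingAlgebra g, ∀ p, g.toFun (ι p) (K (ι p)) (K (ι p)) = 0 ∧
    K (ι p) ∈ hypersurfaceTangent (E := E) (E' := E') ι p ∧ K (ι p) ≠ 0

/-- Every Killing vector field of `g` is tangent to `H = ι(N)`. -/
def IsKillingInvariant (g : LorentzMetric E M) (ι : N → M) : Prop :=
  ∀ X ∈ killingAlgebra g, ∀ p, X (ι p) ∈ hypersurfaceTangent (E := E) (E' := E') ι p

end Horizon

end KillingHorizons

end

open KillingHorizons
open scoped Manifold ContDiff

/-! The derived series decreases, so of two centres `𝔷(𝔯_i)`, `𝔷(𝔯_j)` the one with larger index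
lies in the ideal that the other centralizes; hence `𝔞(𝔯)` is abelian. Every `X ∈ 𝔤` acts on `𝔨` as
a derivation, and the radical, its derived series and their centres are stable under derivations
(`derivation_mem_radicalAbelianIdeal`). For the radical this rests on characteristic zero: if `I` is
solvable, so is `I + D(I) + … + Dᵐ(I)`.

For the horizon, let `K` be its generator and `J` the set of Killing fields that are multiples of
`K` along `H`. Invariance of `H` makes `J` an ideal. At each point `p` of `H` there is a number `κ`,
essentially the surface gravity, such that `[K, [K, X]] = κ [K, X]` at `p` for all `X ∈ J`. Since
`[X, Y] = x [K, Y] - y [K, X]` wherever `X = xK` and `Y = yK`, the operator `ad K` acts on `[J, J]`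
at `p` as multiplication by `κ`, and so brackets of elements of `[J, J]` vanish along `H`. A Killing
field vanishing on a hypersurface is zero: its derivative at a zero is skew and kills a hyperplane,
so its `1`-jet vanishes. Thus `J` is solvable (`derivedSeries_nullIdeal_eq_bot`) and nonzero, and
therefore it meets `𝔞(𝔯)` (`exists_ne_zero_mem_radicalAbelianIdeal`). A nonzero `Y` in the
intersection is normal to `H`, hence orthogonal along `H` to every Killing field, and its
coefficients give a null vector of the Gram matrix of the `K_i`.

This needs `𝔨` to be finite-dimensional, so that its radical is solvable. The Killing equation
expresses second derivatives of a Killing field through its `1`-jet, so a uniqueness theorem for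
ODEs along segments, together with connectedness, shows that the `1`-jet at one point determines the
field (`IsKilling.eq_zero`).

For the relative invariant, write `[X, K_i] = ∑ C_ik K_k`. The prolongation preserves `h`, so it
changes the Gram matrix `P` by `C P + P Cᵀ`, and `det P` by `2 tr(C) det P`, while `L_X` multiplies
the wedge by `tr C`. The weight is the trace of `ad X` on `𝔞(𝔯)`. -/

namespace KillingHorizons

/-! ### Derivations, the radical and the ideal `𝔞(𝔯)` of a real Lie algebra. -/

section LieAlgebra

open LieAlgebra

variable {L : Type*} [LieRing L] [LieAlgebra ℝ L]

/-- The ideal `I + D(I)`, for a derivation `D`. -/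
def addDerivation (D : LieDerivation ℝ L L) (I : LieIdeal ℝ L) : LieIdeal ℝ L where
  carrier := {x | ∃ y ∈ I, ∃ z ∈ I, x = y + D z}
  zero_mem' := ⟨0, I.zero_mem, 0, I.zero_mem, by simp⟩
  add_mem' := by
    rintro _ _ ⟨y, hy, z, hz, rfl⟩ ⟨y', hy', z', hz', rfl⟩
    exact ⟨y + y', I.add_mem hy hy', z + z', I.add_mem hz hz', by rw [map_add]; abel⟩
  smul_mem' := by
    rintro c _ ⟨y, hy, z, hz, rfl⟩
    exact ⟨c • y, I.smul_mem c hy, c • z, I.smul_mem c hz, by rw [map_smul, smul_add]⟩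
  lie_mem := by
    rintro x _ ⟨y, hy, z, hz, rfl⟩
    refine ⟨⁅x, y⁆ - ⁅D x, z⁆, I.sub_mem (LieSubmodule.lie_mem I hy) (LieSubmodule.lie_mem I hz),
      ⁅x, z⁆, LieSubmodule.lie_mem I hz, ?_⟩
    rw [lie_add, D.apply_lie_eq_add]
    abel

theorem le_addDerivation (D : LieDerivation ℝ L L) (I : LieIdeal ℝ L) : I ≤ addDerivation D I :=
  fun x hx => ⟨x, hx, 0, I.zero_mem, by simp⟩

theorem apply_mem_addDerivation (D : LieDerivation ℝ L L) {I : LieIdeal ℝ L} {x : L} (hx : x ∈ I) :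
    D x ∈ addDerivation D I :=
  ⟨0, I.zero_mem, x, hx, by simp⟩

/-- The ideal `I + D(I) + … + Dᵐ(I)`. -/
def derivationSum (D : LieDerivation ℝ L L) (I : LieIdeal ℝ L) (m : ℕ) : LieIdeal ℝ L :=
  (addDerivation D)^[m] I

theorem derivationSum_succ (D : LieDerivation ℝ L L) (I : LieIdeal ℝ L) (m : ℕ) :
    derivationSum D I (m + 1) = addDerivation D (derivationSum D I m) :=
  Function.iterate_succ_apply' _ _ _

theorem derivationSum_mono (D : LieDerivation ℝ L L) (I : LieIdeal ℝ L) :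
    Monotone (derivationSum D I) :=
  monotone_nat_of_le_succ fun m => by
    rw [derivationSum_succ]
    exact le_addDerivation D _

theorem iterate_mem_derivationSum (D : LieDerivation ℝ L L) {I : LieIdeal ℝ L} {x : L} (hx : x ∈ I) :
    ∀ m, D^[m] x ∈ derivationSum D I m
  | 0 => hx
  | m + 1 => by
    rw [derivationSum_succ, Function.iterate_succ_apply']
    exact apply_mem_addDerivation D (iterate_mem_derivationSum D hx m)

theorem exists_of_mem_derivationSum_succ (D : LieDerivation ℝ L L) (I : LieIdeal ℝ L) (m : ℕ) :
    ∀ z ∈ derivationSum D I (m + 1), ∃ t ∈ derivationSum D I m, ∃ x ∈ I, z = t + D^[m + 1] x := by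
  induction m with
  | zero =>
    rintro _ ⟨y, hy, w, hw, rfl⟩
    exact ⟨y, hy, w, hw, rfl⟩
  | succ m ih =>
    intro z hz
    rw [derivationSum_succ] at hz
    obtain ⟨y, hy, w, hw, rfl⟩ := hz
    obtain ⟨t, ht, x, hx, rfl⟩ := ih w hw
    refine ⟨y + D t, (derivationSum D I (m + 1)).add_mem hy ?_, x, hx, ?_⟩
    · rw [derivationSum_succ]
      exact apply_mem_addDerivation D ht
    · rw [map_add, Function.iterate_succ_apply' _ (m + 1), add_assoc]

/-- In characteristic zero, `[Dᵐx, Dᵐy]` is a multiple of `D²ᵐ[x, y]` up to brackets with terms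
`Dⁱx`, `Dⁱy` of lower order. -/
theorem lie_iterate_mem (D : LieDerivation ℝ L L) (I : LieIdeal ℝ L) (m : ℕ) {x y : L} (hx : x ∈ I)
    (hy : y ∈ I) : ⁅D^[m + 1] x, D^[m + 1] y⁆ ∈
      derivationSum D I m ⊔ derivationSum D ⁅I, I⁆ (2 * (m + 1)) := by
  set T := derivationSum D I m ⊔ derivationSum D ⁅I, I⁆ (2 * (m + 1)) with hT
  have hlow : ∀ i ≤ m, ∀ z ∈ I, D^[i] z ∈ T := fun i hi z hz =>
    (le_sup_left : _ ≤ T) (derivationSum_mono D I hi (iterate_mem_derivationSum D hz i))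
  have hD : D^[2 * (m + 1)] ⁅x, y⁆ ∈ T :=
    (le_sup_right : _ ≤ T) (iterate_mem_derivationSum D (LieSubmodule.lie_mem_lie hx hy) _)
  -- Leibniz expansion of `D²ᵐ⁺²[x, y]`. The exponents add up to `2(m + 1)`, so off the middle term
  -- one of them is at most `m` and the bracket lies in the ideal `T`; the middle binomial
  -- coefficient is invertible over `ℝ`.
  rw [LieDerivation.iterate_apply_lie,
    ← Finset.add_sum_erase _ _ (a := (m + 1, m + 1)) (by simp; ring)] at hD
  have hrest : ∑ ij ∈ (Finset.HasAntidiagonal.antidiagonal (2 * (m + 1))).erase (m + 1, m + 1),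
      (2 * (m + 1)).choose ij.1 • ⁅D^[ij.1] x, D^[ij.2] y⁆ ∈ T := by
    refine sum_mem fun ij hij => nsmul_mem ?_ _
    rw [Finset.mem_erase, Finset.HasAntidiagonal.mem_antidiagonal] at hij
    rcases le_or_gt ij.1 m with h | h
    · exact lie_mem_left _ _ _ _ _ (hlow _ h x hx)
    · refine LieSubmodule.lie_mem T (hlow _ ?_ y hy)
      have : ij.1 ≠ m + 1 := fun e => hij.1 (Prod.ext e (by simp only; lia))
      lia
  have h := (add_mem_cancel_right hrest).1 hD
  have hc : ((2 * (m + 1)).choose (m + 1) : ℝ) ≠ 0 := by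
    exact_mod_cast (Nat.choose_pos (by lia)).ne'
  rw [← Nat.cast_smul_eq_nsmul ℝ] at h
  simpa [smul_smul, inv_mul_cancel₀ hc] using T.smul_mem ((2 * (m + 1)).choose (m + 1) : ℝ)⁻¹ h

theorem derivedSeries_sup_eq_bot {I J : LieIdeal ℝ L} {k l : ℕ}
    (hI : derivedSeriesOfIdeal ℝ L k I = ⊥) (hJ : derivedSeriesOfIdeal ℝ L l J = ⊥) :
    derivedSeriesOfIdeal ℝ L (k + l) (I ⊔ J) = ⊥ := by
  rw [← le_bot_iff]
  have := derivedSeriesOfIdeal_add_le_add (R := ℝ) (L := L) (I := I) J k l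
  rwa [hI, hJ, LieSubmodule.add_eq_sup, LieSubmodule.add_eq_sup, sup_bot_eq] at this

/-- Double induction, on the derived length of `I` and on `m`. By `lie_iterate_mem`, the derived
ideal of `I + … + Dᵐ⁺¹(I)` lies in the sum of `I + … + Dᵐ(I)`, solvable by induction on `m`, and of
the sum of order `2(m + 1)` built on `[I, I]`, whose derived length is smaller. The outer hypothesis
is used for another ideal and a larger order, hence the quantifiers inside. -/
theorem exists_derivedSeries_derivationSum_eq_bot (D : LieDerivation ℝ L L) (k : ℕ) :
    ∀ I : LieIdeal ℝ L, derivedSeriesOfIdeal ℝ L k I = ⊥ →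
      ∀ m, ∃ l, derivedSeriesOfIdeal ℝ L l (derivationSum D I m) = ⊥ := by
  induction k with
  | zero =>
    intro I hI m
    refine ⟨0, ?_⟩
    rw [derivedSeriesOfIdeal_zero] at hI ⊢
    subst hI
    induction m with
    | zero => rfl
    | succ m ih =>
      rw [derivationSum_succ, ih, ← le_bot_iff]
      rintro _ ⟨y, hy, z, hz, rfl⟩
      rw [LieSubmodule.mem_bot] at hy hz ⊢
      simp [hy, hz]
  | succ k ihk =>
    intro I hI m
    have hI' : derivedSeriesOfIdeal ℝ L k ⁅I, I⁆ = ⊥ := by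
      rw [derivedSeriesOfIdeal_add] at hI
      simpa using hI
    induction m with
    | zero => exact ⟨k + 1, hI⟩
    | succ m ihm =>
      obtain ⟨l₁, h₁⟩ := ihm
      obtain ⟨l₂, h₂⟩ := ihk _ hI' (2 * (m + 1))
      refine ⟨l₁ + l₂ + 1, ?_⟩
      rw [derivedSeriesOfIdeal_add, ← le_bot_iff, ← derivedSeries_sup_eq_bot h₁ h₂]
      refine derivedSeriesOfIdeal_mono ?_ _
      rw [derivedSeriesOfIdeal_succ, derivedSeriesOfIdeal_zero, LieSubmodule.lieIdeal_oper_eq_span,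
        LieSubmodule.lieSpan_le]
      rintro _ ⟨⟨u, hu⟩, ⟨v, hv⟩, rfl⟩
      obtain ⟨t, ht, x, hx, rfl⟩ := exists_of_mem_derivationSum_succ D I m u hu
      obtain ⟨s, hs, y, hy, rfl⟩ := exists_of_mem_derivationSum_succ D I m v hv
      have ht' := (le_sup_left : _ ≤ derivationSum D I m ⊔ derivationSum D ⁅I, I⁆ (2 * (m + 1))) ht
      have hs' := (le_sup_left : _ ≤ derivationSum D I m ⊔ derivationSum D ⁅I, I⁆ (2 * (m + 1))) hs
      simp only [add_lie, lie_add]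
      exact add_mem (add_mem (LieSubmodule.lie_mem _ hs') (LieSubmodule.lie_mem _ hs'))
        (add_mem (lie_mem_left _ _ _ _ _ ht') (lie_iterate_mem D I m hx hy))

theorem le_radical_of_derivedSeries_eq_bot {I : LieIdeal ℝ L} {k : ℕ}
    (h : derivedSeriesOfIdeal ℝ L k I = ⊥) : I ≤ radical ℝ L :=
  le_sSup (IsSolvable.mk (R := ℝ) (k := k) ((LieIdeal.derivedSeries_eq_bot_iff I k).2 h))

/-- The radical is the sum of all solvable ideals, and `D` maps a solvable `I` into the solvable
ideal `I + D(I)`. No finiteness of dimension enters. -/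
theorem derivation_mem_radical (D : LieDerivation ℝ L L) {x : L} (hx : x ∈ radical ℝ L) :
    D x ∈ radical ℝ L := by
  have h : (radical ℝ L).toSubmodule ≤ (radical ℝ L).toSubmodule.comap D.toLinearMap := by
    rw [radical, LieSubmodule.sSup_toSubmodule, sSup_le_iff]
    rintro _ ⟨I, hI, rfl⟩ y hy
    obtain ⟨k, hk⟩ := hI.solvable (R := ℝ)
    rw [LieIdeal.derivedSeries_eq_bot_iff] at hk
    obtain ⟨l, hl⟩ := exists_derivedSeries_derivationSum_eq_bot D k I hk 1
    have := le_radical_of_derivedSeries_eq_bot hl (apply_mem_addDerivation D hy)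
    rwa [radical, ← LieSubmodule.mem_toSubmodule, LieSubmodule.sSup_toSubmodule] at this
  exact h hx

theorem derivation_mem_derivedSeriesOfIdeal (D : LieDerivation ℝ L L) {I : LieIdeal ℝ L}
    (hI : ∀ x ∈ I, D x ∈ I) (k : ℕ) :
    ∀ x ∈ derivedSeriesOfIdeal ℝ L k I, D x ∈ derivedSeriesOfIdeal ℝ L k I := by
  induction k with
  | zero => exact hI
  | succ k ih =>
    rw [derivedSeriesOfIdeal_succ]
    set J := derivedSeriesOfIdeal ℝ L k I
    have h : (⁅J, J⁆ : LieIdeal ℝ L).toSubmodule ≤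
        (⁅J, J⁆ : LieIdeal ℝ L).toSubmodule.comap D.toLinearMap := by
      conv_lhs => rw [LieSubmodule.lieIdeal_oper_eq_linear_span']
      rw [Submodule.span_le]
      rintro _ ⟨x, hx, y, hy, rfl⟩
      change D ⁅x, y⁆ ∈ ⁅J, J⁆
      rw [D.apply_lie_eq_add]
      exact add_mem (LieSubmodule.lie_mem_lie hx (ih y hy)) (LieSubmodule.lie_mem_lie (ih x hx) hy)
    exact fun x hx => h hx

/-- Apply `D` to `[x, y] = 0`: the term `[x, D y]` drops out because `D y` stays in `I`. -/
theorem derivation_mem_idealCenter (D : LieDerivation ℝ L L) {I : LieIdeal ℝ L}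
    (hI : ∀ x ∈ I, D x ∈ I) {x : L} (hx : x ∈ idealCenter I) : D x ∈ idealCenter I := by
  refine ⟨hI x hx.1, fun y hy => ?_⟩
  have h := D.apply_lie_eq_add x y
  rw [hx.2 y hy, map_zero, hx.2 _ (hI y hy), zero_add] at h
  exact h.symm

/-- The ideal `𝔞(𝔯)` is characteristic. -/
theorem derivation_mem_radicalAbelianIdeal (D : LieDerivation ℝ L L) {x : L}
    (hx : x ∈ radicalAbelianIdeal L) : D x ∈ radicalAbelianIdeal L := by
  have h : (radicalAbelianIdeal L).toSubmodule ≤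
      (radicalAbelianIdeal L).toSubmodule.comap D.toLinearMap := by
    conv_lhs => rw [radicalAbelianIdeal, LieSubmodule.iSup_toSubmodule]
    refine iSup_le fun i y hy => ?_
    exact le_iSup (fun i : ℕ => idealCenter (derivedSeriesOfIdeal ℝ L i (radical ℝ L))) i
      (derivation_mem_idealCenter D (derivation_mem_derivedSeriesOfIdeal D
        (fun x hx => derivation_mem_radical D hx) i) hy)
  exact h hx

theorem lie_idealCenter_derivedSeries_eq_zero (I : LieIdeal ℝ L) {i j : ℕ} {x y : L}
    (hx : x ∈ idealCenter (derivedSeriesOfIdeal ℝ L i I))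
    (hy : y ∈ idealCenter (derivedSeriesOfIdeal ℝ L j I)) : ⁅x, y⁆ = 0 := by
  rcases le_total i j with h | h
  · exact hx.2 y (derivedSeriesOfIdeal_antitone I h hy.1)
  · rw [← lie_skew, hy.2 x (derivedSeriesOfIdeal_antitone I h hx.1), neg_zero]

/-- The ideal `𝔞(𝔯)` is abelian. -/
theorem lie_radicalAbelianIdeal_eq_zero {x y : L} (hx : x ∈ radicalAbelianIdeal L)
    (hy : y ∈ radicalAbelianIdeal L) : ⁅x, y⁆ = 0 := by
  rw [radicalAbelianIdeal, ← LieSubmodule.mem_toSubmodule, LieSubmodule.iSup_toSubmodule] at hx hy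
  induction hx using Submodule.iSup_induction' with
  | mem i x hx =>
    induction hy using Submodule.iSup_induction' with
    | mem j y hy => exact lie_idealCenter_derivedSeries_eq_zero _ hx hy
    | zero => exact lie_zero x
    | add y z _ _ ihy ihz => rw [lie_add, ihy, ihz, add_zero]
  | zero => exact zero_lie y
  | add x z _ _ ihx ihz => rw [add_lie, ihx, ihz, add_zero]

/-- A nonzero solvable ideal meets `𝔞(𝔯)`. -/
theorem exists_ne_zero_mem_radicalAbelianIdeal [IsNoetherian ℝ L] {J : LieIdeal ℝ L} {k : ℕ}
    (hJ : derivedSeriesOfIdeal ℝ L k J = ⊥) (hne : J ≠ ⊥) :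
    ∃ x ∈ J, x ≠ 0 ∧ x ∈ radicalAbelianIdeal L := by
  classical
  obtain ⟨l, hl⟩ := (radicalIsSolvable (R := ℝ) (L := L)).solvable (R := ℝ)
  rw [LieIdeal.derivedSeries_eq_bot_iff] at hl
  have hex : ∃ i, derivedSeriesOfIdeal ℝ L i (radical ℝ L) ⊓ J = ⊥ := ⟨l, by rw [hl, bot_inf_eq]⟩
  -- The first index at which `𝔯_i ∩ J` becomes zero is not `0`, since a solvable `J` lies in the
  -- radical. One step earlier the intersection is nonzero, and its brackets with `𝔯_i` fall into
  -- `𝔯_{i+1} ∩ J = 0`, so it is central in `𝔯_i`.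
  obtain ⟨i, hi⟩ : ∃ i, Nat.find hex = i + 1 := by
    refine Nat.exists_eq_succ_of_ne_zero fun h0 => hne ?_
    have := Nat.find_spec hex
    rwa [h0, derivedSeriesOfIdeal_zero,
      inf_eq_right.2 (le_radical_of_derivedSeries_eq_bot hJ)] at this
  have h1 : derivedSeriesOfIdeal ℝ L (i + 1) (radical ℝ L) ⊓ J = ⊥ := hi ▸ Nat.find_spec hex
  have h2 : derivedSeriesOfIdeal ℝ L i (radical ℝ L) ⊓ J ≠ ⊥ := Nat.find_min hex (by lia)
  rw [Ne, LieSubmodule.eq_bot_iff] at h2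
  push Not at h2
  obtain ⟨x, hx, hx0⟩ := h2
  rw [LieSubmodule.mem_inf] at hx
  refine ⟨x, hx.2, hx0, ?_⟩
  refine le_iSup (fun i : ℕ => idealCenter (derivedSeriesOfIdeal ℝ L i (radical ℝ L))) i
    ⟨hx.1, fun y hy => ?_⟩
  rw [← LieSubmodule.mem_bot (R := ℝ) (L := L), ← h1, LieSubmodule.mem_inf,
    derivedSeriesOfIdeal_succ]
  exact ⟨LieSubmodule.lie_mem_lie hx.1 hy, lie_mem_left _ _ _ _ _ hx.2⟩

end LieAlgebra

end KillingHorizons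

/-! ### Gram determinants and their derivatives along prolonged vector fields. -/

namespace KillingHorizons

open Bundle Set VectorField
open scoped Manifold ContDiff Topology

set_option linter.unusedSectionVars false

section Determinant

variable {n : Type*} [Fintype n] [DecidableEq n]

/-- Expanding along the replaced row yields entries of the adjugate. The sum is the derivative of
`det` at `P` in the direction `B`, so this is Jacobi's formula. -/
theorem sum_det_updateRow (P B : Matrix n n ℝ) :
    ∑ i, (P.updateRow i (B i)).det = (P.adjugate * B).trace := by
  have h : ∀ i, (P.updateRow i (B i)).det = ∑ j, P.adjugate j i * B i j := fun i => by
    rw [← Matrix.cramer_transpose_apply, Matrix.cramer_eq_adjugate_mulVec, ← Matrix.adjugate_transpose]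
    rfl
  simp only [h, Matrix.trace, Matrix.diag, Matrix.mul_apply]
  exact Finset.sum_comm

/-- The infinitesimal form of `det (A P Aᵀ) = (det A)² det P`. -/
theorem sum_det_updateRow_congruence (P C : Matrix n n ℝ) :
    ∑ i, (P.updateRow i ((C * P + P * C.transpose) i)).det = 2 * C.trace * P.det := by
  rw [sum_det_updateRow, Matrix.mul_add, Matrix.trace_add, ← Matrix.mul_assoc, Matrix.trace_mul_comm,
    ← Matrix.mul_assoc, ← Matrix.mul_assoc, Matrix.mul_adjugate, Matrix.adjugate_mul,
    Matrix.smul_mul, Matrix.smul_mul, Matrix.one_mul, Matrix.one_mul, Matrix.trace_smul,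
    Matrix.trace_smul, Matrix.trace_transpose, smul_eq_mul]
  ring

theorem hasMFDerivAt_det {EN HN N : Type*} [NormedAddCommGroup EN] [NormedSpace ℝ EN]
    [TopologicalSpace HN] {I : ModelWithCorners ℝ EN HN} [TopologicalSpace N] [ChartedSpace HN N]
    {φ : N → n → n → ℝ} {φ' : n → n → EN →L[ℝ] ℝ} {x : N}
    (h : ∀ i j, HasMFDerivAt I 𝓘(ℝ, ℝ) (fun η => φ η i j) x (φ' i j)) :
    ∃ D : EN →L[ℝ] ℝ, HasMFDerivAt I 𝓘(ℝ, ℝ) (fun η => (Matrix.of (φ η)).det) x D ∧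
      ∀ v, D v = ∑ i, ((Matrix.of (φ x)).updateRow i (fun j => φ' i j v)).det := by
  let det : ContinuousMultilinearMap ℝ (fun _ : n => n → ℝ) ℝ :=
    ⟨Matrix.detRowAlternating.toMultilinearMap, Continuous.matrix_det continuous_id⟩
  have hc : ContinuousAt φ x :=
    continuousAt_pi.2 fun i => continuousAt_pi.2 fun j => (h i j).1
  let Φ : EN →L[ℝ] (n → n → ℝ) := ContinuousLinearMap.pi fun i => ContinuousLinearMap.pi (φ' i)
  have hφ : HasMFDerivAt I 𝓘(ℝ, n → n → ℝ) φ x Φ :=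
    ⟨hc, hasFDerivWithinAt_pi.2 fun i => hasFDerivWithinAt_pi.2 fun j => (h i j).2⟩
  have hdet : HasMFDerivAt 𝓘(ℝ, n → n → ℝ) 𝓘(ℝ, ℝ) (fun A : n → n → ℝ => Matrix.det A) (φ x)
      (det.linearDeriv (φ x)) := (det.hasFDerivAt (φ x)).hasMFDerivAt
  refine ⟨_, hdet.comp x hφ, fun v => ?_⟩
  exact det.linearDeriv_apply (φ x) (Φ v)

end Determinant

variable {E : Type*} [NormedAddCommGroup E] [NormedSpace ℝ E] [FiniteDimensional ℝ E]
  {M : Type*} [TopologicalSpace M] [ChartedSpace E M] [IsManifold 𝓘(ℝ, E) ∞ M]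

/-- Evaluation of vector fields at a point. -/
noncomputable def VField.evalAt (a : M) : VField E M →ₗ[ℝ] TangentSpace 𝓘(ℝ, E) a where
  toFun X := X a
  map_add' _ _ := rfl
  map_smul' _ _ := rfl

theorem VField.evalAt_apply (a : M) (X : VField E M) : VField.evalAt a X = X a := rfl

theorem VField.sum_smul_apply {ι : Type*} (s : Finset ι) (c : ι → ℝ) (K : ι → VField E M) (a : M) :
    (∑ k ∈ s, c k • K k) a = ∑ k ∈ s, c k • K k a := by
  simp only [← VField.evalAt_apply, map_sum, map_smul]

theorem wedgeNormSq_eq_det {V : Type*} [AddCommGroup V] [Module ℝ V] (B : V →ₗ[ℝ] V →ₗ[ℝ] ℝ)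
    {r : ℕ} (v : Fin r → V) :
    wedgeNormSq B v = (Matrix.of fun i j => B (v j) (v i)).det := by
  simp only [wedgeNormSq, exteriorForm, LinearMap.comp_apply, exteriorPower.map_apply_ιMulti]
  erw [exteriorPower.pairingDual_ιMulti_ιMulti]
  rfl

/-- The form `h` only sees projections to `M`, so the prolongations contribute nothing beyond the
`K_i` themselves. -/
theorem wedgeInvariant_eq_det {r : ℕ} (K : Fin r → VField E M) (θ : BilinBundle E M) :
    wedgeInvariant K θ = (Matrix.of fun i j => θ.2 (K j θ.proj) (K i θ.proj)).det := by
  rw [wedgeInvariant, wedgeNormSq_eq_det]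
  congr
  ext i j
  simp only [horizontalForm, LinearMap.compl₁₂_apply]
  erw [proj_prolong, proj_prolong]
  rfl

theorem metricWedgeNormSq_eq_det (g : LorentzMetric E M) {r : ℕ} (K : Fin r → VField E M) (a : M) :
    metricWedgeNormSq g K a = (Matrix.of fun i j => g.toFun a (K j a) (K i a)).det := by
  rw [metricWedgeNormSq, wedgeNormSq_eq_det]
  rfl

theorem VField.contMDiffAt_coord (Y : VField E M) (a : M) :
    ContMDiffAt 𝓘(ℝ, E) 𝓘(ℝ, E) ∞ (VField.coord a Y) a :=
  ((contMDiffAt_totalSpace).1 (Y.contMDiff a)).2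

theorem contMDiff_eval (Y Z : VField E M) :
    ContMDiff (bilinModel E) 𝓘(ℝ, ℝ) ∞
      (fun η : BilinBundle E M => η.2 (Y η.proj) (Z η.proj)) := by
  intro θ
  have hs : ContMDiffAt (bilinModel E) 𝓘(ℝ, E →L[ℝ] E →L[ℝ] ℝ) ∞ (fun η : BilinBundle E M =>
      ((trivializationAt (E →L[ℝ] E →L[ℝ] ℝ) (fun x : M => TangentSpace 𝓘(ℝ, E) x →L[ℝ]
        TangentSpace 𝓘(ℝ, E) x →L[ℝ] ℝ) θ.proj) η).2) θ :=
    (contMDiffAt_totalSpace.1 contMDiffAt_id).2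
  have hp : ContMDiffAt (bilinModel E) 𝓘(ℝ, E) ∞ (TotalSpace.proj : BilinBundle E M → M) θ :=
    contMDiffAt_proj _
  have hW : ∀ W : VField E M, ContMDiffAt (bilinModel E) 𝓘(ℝ, E) ∞
      (fun η : BilinBundle E M => VField.coord θ.proj W η.proj) θ := fun W =>
    (W.contMDiffAt_coord θ.proj).comp θ hp
  refine ((hs.clm_apply (hW Y)).clm_apply (hW Z)).congr_of_eventuallyEq ?_
  filter_upwards [(FiberBundle.continuous_proj (E →L[ℝ] E →L[ℝ] ℝ) (fun x : M =>
    TangentSpace 𝓘(ℝ, E) x →L[ℝ] TangentSpace 𝓘(ℝ, E) x →L[ℝ] ℝ)).continuousAt.preimage_mem_nhds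
    (chart_source_mem_nhds E θ.proj)] with η hη
  exact eval_eq Y Z θ η hη

theorem contMDiff_wedgeInvariant {r : ℕ} (K : Fin r → VField E M) :
    ContMDiff (bilinModel E) 𝓘(ℝ, ℝ) ∞ (wedgeInvariant K) := by
  simp only [funext (wedgeInvariant_eq_det K), Matrix.det_apply', Matrix.of_apply]
  refine contMDiff_finsetSum fun σ _ => contMDiff_const.mul ?_
  exact contMDiff_finsetProd fun i _ => contMDiff_eval _ _

/-- Because `L_{X⁽⁰⁾} h = 0` (`lie_prolong`), only the brackets `[X, K_i]` contribute to the
derivative of the Gram matrix `P`, which is `C P + P Cᵀ`. -/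
theorem mvfderiv_wedgeInvariant {r : ℕ} (K : Fin r → VField E M) (X : VField E M)
    (C : Matrix (Fin r) (Fin r) ℝ) (hC : ∀ i, ⁅X, K i⁆ = ∑ k, C i k • K k) (θ : BilinBundle E M) :
    mvfderiv (bilinModel E) (wedgeInvariant K) θ (prolong X θ) =
      2 * C.trace * wedgeInvariant K θ := by
  have h : ∀ i j, HasMFDerivAt (bilinModel E) 𝓘(ℝ, ℝ)
      (fun η : BilinBundle E M => (fun i j => η.2 (K j η.proj) (K i η.proj)) i j) θ
      (mvfderiv (bilinModel E) (fun η : BilinBundle E M => η.2 (K j η.proj) (K i η.proj)) θ) :=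
    fun i j => ((contMDiff_eval (K j) (K i) θ).mdifferentiableAt (by simp)).hasMFDerivAt
  obtain ⟨D, hD, hDv⟩ := hasMFDerivAt_det
    (φ := fun (η : BilinBundle E M) i j => η.2 (K j η.proj) (K i η.proj)) h
  rw [wedgeInvariant_eq_det, ← sum_det_updateRow_congruence, funext (wedgeInvariant_eq_det K)]
  have e : mvfderiv (bilinModel E) (fun η : BilinBundle E M =>
      (Matrix.of fun i j => η.2 (K j η.proj) (K i η.proj)).det) θ = D := hD.mfderiv
  rw [e]
  refine (hDv _).trans ?_
  refine Finset.sum_congr rfl fun i _ => congrArg _ (congrArg _ (funext fun j => ?_))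
  refine (lie_prolong X (K j) (K i) θ).trans ?_
  have hev : ∀ i, ⁅X, K i⁆ θ.proj = ∑ k, C i k • K k θ.proj := fun i => by
    rw [hC, VField.sum_smul_apply]
  rw [hev, hev]
  simp only [map_sum, map_smul, sum_apply, smul_apply, smul_eq_mul, Matrix.add_apply,
    Matrix.mul_apply, Matrix.of_apply, Matrix.transpose_apply]
  rw [add_comm]
  simp [mul_comm]

/-- In the `i`-th summand only `C i i` survives: every other `K k` is already a factor of the wedge.
-/
theorem lieWedgeAt_eq {r : ℕ} (K : Fin r → VField E M) (X : VField E M)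
    (C : Matrix (Fin r) (Fin r) ℝ) (hC : ∀ i, ⁅X, K i⁆ = ∑ k, C i k • K k) (a : M) :
    lieWedgeAt X K a = C.trace • wedgeAt K a := by
  have hev : ∀ i, ⁅X, K i⁆ a = ∑ k, C i k • K k a := fun i => by
    rw [hC, VField.sum_smul_apply]
  simp only [lieWedgeAt, wedgeAt, Matrix.trace, Matrix.diag, Finset.sum_smul]
  refine Finset.sum_congr rfl fun i _ => ?_
  have hu : (fun j => (Function.update K i ⁅X, K i⁆ j) a) =
      Function.update (fun j => K j a) i (∑ k, C i k • K k a) := by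
    funext j
    rcases eq_or_ne j i with rfl | h
    · simp [hev]
    · simp [h]
  rw [hu]
  erw [AlternatingMap.map_update_sum]
  rw [Finset.sum_eq_single i]
  · erw [AlternatingMap.map_update_smul, Function.update_eq_self]
  · intro k _ hk
    erw [AlternatingMap.map_update_smul, AlternatingMap.map_update_self _ _ hk.symm, smul_zero]
  · simp

end KillingHorizons

/-! ### The Killing equation on a vector space. -/

namespace KillingHorizons

open scoped ContDiff Topology

set_option maxSynthPendingDepth 4
set_option linter.unusedSectionVars false

section Flat

variable {E : Type*} [NormedAddCommGroup E] [NormedSpace ℝ E]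

/-- The Killing operator `(L_x G)(u, v)` of a vector field `x` on a vector space. -/
noncomputable def flatKilling (G : E → E →L[ℝ] E →L[ℝ] ℝ) (x : E → E) (u v z : E) : ℝ :=
  fderiv ℝ G z (x z) u v + G z (fderiv ℝ x z u) v + G z u (fderiv ℝ x z v)

theorem fderiv_flatKilling {G : E → E →L[ℝ] E →L[ℝ] ℝ} {x : E → E} {z : E}
    (hG : ContDiffAt ℝ 2 G z) (hx : ContDiffAt ℝ 2 x z) (u v w : E) :
    fderiv ℝ (flatKilling G x u v) z w =
      (fderiv ℝ (fderiv ℝ G) z w (x z) u v + fderiv ℝ G z (fderiv ℝ x z w) u v +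
        fderiv ℝ G z w (fderiv ℝ x z u) v + fderiv ℝ G z w u (fderiv ℝ x z v)) +
      (G z (fderiv ℝ (fderiv ℝ x) z w u) v + G z u (fderiv ℝ (fderiv ℝ x) z w v)) := by
  have hG1 := (hG.differentiableAt (by simp)).hasFDerivAt
  have hx1 := (hx.differentiableAt (by simp)).hasFDerivAt
  have hG2 := ((hG.fderiv_right (m := 1) (by norm_num)).differentiableAt (by simp)).hasFDerivAt
  have hx2 := ((hx.fderiv_right (m := 1) (by norm_num)).differentiableAt (by simp)).hasFDerivAt
  have hc : ∀ c : E, HasFDerivAt (fun _ : E => c) (0 : E →L[ℝ] E) z := fun c => hasFDerivAt_const c z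
  have h := (((hG2.clm_apply hx1).clm_apply (hc u)).clm_apply (hc v)).add
    (((hG1.clm_apply (hx2.clm_apply (hc u))).clm_apply (hc v)).add
      ((hG1.clm_apply (hc u)).clm_apply (hx2.clm_apply (hc v))))
  rw [HasFDerivAt.fderiv (f := flatKilling G x u v)
    (h.congr_of_eventuallyEq (Filter.Eventually.of_forall fun z => add_assoc _ _ _))]
  simp
  ring

/-- An injective linear map in finite dimension is bounded below at `z₀`. For `z` close to `z₀` the
perturbation costs at most `‖u‖ / 2`, which is absorbed at the price of doubling the constant. -/
theorem exists_norm_le_of_nondegenerate [FiniteDimensional ℝ E] {G : E → E →L[ℝ] E →L[ℝ] ℝ} {z₀ : E}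
    (hG : ContinuousAt G z₀) (hn : ∀ u, (∀ v, G z₀ u v = 0) → u = 0) :
    ∃ c : ℝ, 0 < c ∧ ∀ᶠ z in 𝓝 z₀, ∀ u, ‖u‖ ≤ c * ‖G z u‖ := by
  obtain ⟨K, hK, hKl⟩ := (G z₀).toLinearMap.exists_antilipschitzWith
    (LinearMap.ker_eq_bot'.2 fun u hu => hn u fun v => by
      rw [show G z₀ u = 0 from hu, zero_apply])
  have hK' : (0 : ℝ) < K := hK
  refine ⟨2 * K, by positivity, ?_⟩
  filter_upwards [Metric.continuousAt_iff'.1 hG (1 / (2 * K)) (by positivity)] with z hz u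
  rw [dist_eq_norm] at hz
  have h1 : ‖u‖ ≤ K * ‖G z₀ u‖ := hKl.le_mul_norm (map_zero _) u
  have h2 : ‖G z₀ u‖ ≤ ‖G z u‖ + 1 / (2 * K) * ‖u‖ := by
    calc ‖G z₀ u‖ = ‖G z u - (G z - G z₀) u‖ := by simp
      _ ≤ ‖G z u‖ + ‖(G z - G z₀) u‖ := norm_sub_le _ _
      _ ≤ _ := by gcongr; exact (G z - G z₀).le_of_opNorm_le hz.le u
  have h3 : K * (1 / (2 * K) * ‖u‖) = ‖u‖ / 2 := by field_simp
  nlinarith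

theorem norm_apply₃_le {D : E →L[ℝ] E →L[ℝ] E →L[ℝ] ℝ} {C : ℝ} (hD : ‖D‖ ≤ C) (u v w : E) :
    ‖D u v w‖ ≤ C * ‖u‖ * ‖v‖ * ‖w‖ := by
  refine ((D u v).le_opNorm w).trans ?_
  gcongr
  refine ((D u).le_opNorm v).trans ?_
  gcongr
  exact D.le_of_opNorm_le hD u

theorem eventually_norm_le {F : Type*} [NormedAddCommGroup F] {f : E → F} {z₀ : E}
    (hf : ContinuousAt f z₀) : ∀ᶠ z in 𝓝 z₀, ‖f z‖ ≤ ‖f z₀‖ + 1 :=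
  (hf.norm.eventually_lt continuousAt_const (lt_add_one _)).mono fun _ hz => hz.le

/-- The second derivatives of a Killing vector field are controlled by its `1`-jet. -/
theorem exists_norm_fderiv_fderiv_le [FiniteDimensional ℝ E] {G : E → E →L[ℝ] E →L[ℝ] ℝ} {x : E → E} {z₀ : E}
    (hG : ContDiffAt ℝ 2 G z₀) (hx : ContDiffAt ℝ 2 x z₀)
    (hn : ∀ u, (∀ v, G z₀ u v = 0) → u = 0) (hs : ∀ᶠ z in 𝓝 z₀, ∀ u v, G z u v = G z v u)
    (hK : ∀ᶠ z in 𝓝 z₀, ∀ u v, flatKilling G x u v z = 0) :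
    ∃ C : ℝ, ∀ᶠ z in 𝓝 z₀, ‖fderiv ℝ (fderiv ℝ x) z‖ ≤ C * ‖(x z, fderiv ℝ x z)‖ := by
  obtain ⟨c, hc0, hc⟩ := exists_norm_le_of_nondegenerate hG.continuousAt hn
  have hG1 : ContinuousAt (fderiv ℝ G) z₀ := (hG.fderiv_right (m := 1) (by norm_num)).continuousAt
  have hG2 : ContinuousAt (fderiv ℝ (fderiv ℝ G)) z₀ :=
    ((hG.fderiv_right (m := 1) (by norm_num)).fderiv_right (m := 0) (by norm_num)).continuousAt
  set C := max (‖fderiv ℝ G z₀‖ + 1) (‖fderiv ℝ (fderiv ℝ G) z₀‖ + 1) with hC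
  have hC0 : 0 ≤ C := (by positivity : 0 ≤ ‖fderiv ℝ G z₀‖ + 1).trans (le_max_left _ _)
  have b1 : ∀ᶠ z in 𝓝 z₀, ‖fderiv ℝ G z‖ ≤ C :=
    (eventually_norm_le hG1).mono fun z hz => hz.trans (le_max_left _ _)
  have b2 : ∀ᶠ z in 𝓝 z₀, ‖fderiv ℝ (fderiv ℝ G) z‖ ≤ C :=
    (eventually_norm_le (F := E →L[ℝ] E →L[ℝ] E →L[ℝ] E →L[ℝ] ℝ) hG2).mono fun z hz => hz.trans (le_max_right _ _)
  refine ⟨c * (6 * C), ?_⟩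
  filter_upwards [hc, b1, b2, hG.eventually (by simp), hx.eventually (by simp), hs,
    eventually_eventually_nhds.2 hK] with z hc b1 b2 hG hx hs hK
  set y := ‖(x z, fderiv ℝ x z)‖ with hy
  have hy1 : ‖x z‖ ≤ y := norm_fst_le (x z, fderiv ℝ x z)
  have hy2 : ‖fderiv ℝ x z‖ ≤ y := norm_snd_le (x z, fderiv ℝ x z)
  have hy0 : 0 ≤ y := norm_nonneg _
  have hsymm : ∀ u v, fderiv ℝ (fderiv ℝ x) z u v = fderiv ℝ (fderiv ℝ x) z v u :=
    (hx.isSymmSndFDerivAt (by simp)).eq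
  let S : E → E → E → ℝ := fun w u v => G z (fderiv ℝ (fderiv ℝ x) z w u) v
  -- Differentiating the Killing equation expresses this sum by four terms in the `1`-jet of `x`,
  -- each bounded by `C y ‖w‖ ‖u‖ ‖v‖`.
  have hS : ∀ w u v, |S w u v + S w v u| ≤ 4 * C * y * (‖w‖ * ‖u‖ * ‖v‖) := by
    intro w u v
    have h0 : fderiv ℝ (flatKilling G x u v) z w = 0 := by
      have : flatKilling G x u v =ᶠ[𝓝 z] fun _ => 0 := hK.mono fun z hz => hz u v
      rw [this.fderiv_eq]
      simp
    rw [fderiv_flatKilling hG hx, hs u, add_eq_zero_iff_neg_eq] at h0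
    have h1 : S w u v + S w v u = _ := h0.symm
    have e : ∀ p : E, ‖fderiv ℝ x z p‖ ≤ y * ‖p‖ := fun p => (fderiv ℝ x z).le_of_opNorm_le hy2 p
    rw [h1, abs_neg, ← Real.norm_eq_abs]
    refine (norm_add₄_le).trans ?_
    have t1 : ‖fderiv ℝ (fderiv ℝ G) z w (x z) u v‖ ≤ C * y * (‖w‖ * ‖u‖ * ‖v‖) := by
      have h3 := (fderiv ℝ (fderiv ℝ G) z).le_of_opNorm_le b2 w
      refine (norm_apply₃_le h3 _ _ _).trans ?_
      calc C * ‖w‖ * ‖x z‖ * ‖u‖ * ‖v‖ ≤ C * ‖w‖ * y * ‖u‖ * ‖v‖ := by gcongr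
        _ = _ := by ring
    have t2 : ‖fderiv ℝ G z (fderiv ℝ x z w) u v‖ ≤ C * y * (‖w‖ * ‖u‖ * ‖v‖) := by
      refine (norm_apply₃_le b1 _ _ _).trans ?_
      calc C * ‖fderiv ℝ x z w‖ * ‖u‖ * ‖v‖ ≤ C * (y * ‖w‖) * ‖u‖ * ‖v‖ := by gcongr; exact e w
        _ = _ := by ring
    have t3 : ‖fderiv ℝ G z w (fderiv ℝ x z u) v‖ ≤ C * y * (‖w‖ * ‖u‖ * ‖v‖) := by
      refine (norm_apply₃_le b1 _ _ _).trans ?_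
      calc C * ‖w‖ * ‖fderiv ℝ x z u‖ * ‖v‖ ≤ C * ‖w‖ * (y * ‖u‖) * ‖v‖ := by gcongr; exact e u
        _ = _ := by ring
    have t4 : ‖fderiv ℝ G z w u (fderiv ℝ x z v)‖ ≤ C * y * (‖w‖ * ‖u‖ * ‖v‖) := by
      refine (norm_apply₃_le b1 _ _ _).trans ?_
      calc C * ‖w‖ * ‖u‖ * ‖fderiv ℝ x z v‖ ≤ C * ‖w‖ * ‖u‖ * (y * ‖v‖) := by gcongr; exact e v
        _ = _ := by ring
    linarith
  -- As for Christoffel symbols: `S` is symmetric in its first two arguments, so `2 S w u v` is the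
  -- sum from `hS` at `(w, u, v)`, plus that at `(u, w, v)`, minus that at `(v, w, u)`. The constant
  -- is `3 · 4 / 2 = 6`.
  have hS' : ∀ w u v, |S w u v| ≤ 6 * C * y * (‖w‖ * ‖u‖ * ‖v‖) := by
    intro w u v
    have h1 := abs_le.1 (hS w u v)
    have h2 := abs_le.1 (hS u w v)
    have h3 := abs_le.1 (hS v w u)
    have s1 : S u w v = S w u v := by simp only [S, hsymm u w]
    have s2 : S v w u = S w v u := by simp only [S, hsymm v w]
    have s3 : S v u w = S u v w := by simp only [S, hsymm v u]
    rw [s1] at h2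
    rw [s2, s3] at h3
    rw [abs_le]
    have q1 : ‖u‖ * ‖w‖ * ‖v‖ = ‖w‖ * ‖u‖ * ‖v‖ := by ring
    have q2 : ‖v‖ * ‖w‖ * ‖u‖ = ‖w‖ * ‖u‖ * ‖v‖ := by ring
    rw [q1] at h2
    rw [q2] at h3
    constructor <;> linarith [h1.1, h1.2, h2.1, h2.2, h3.1, h3.2]
  refine ContinuousLinearMap.opNorm_le_bound _ (by positivity) fun w =>
    ContinuousLinearMap.opNorm_le_bound _ (by positivity) fun u => ?_
  have h := (G z (fderiv ℝ (fderiv ℝ x) z w u)).opNorm_le_bound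
    (M := 6 * C * y * (‖w‖ * ‖u‖)) (by positivity) fun v => by
      have := hS' w u v
      rw [← Real.norm_eq_abs] at this
      refine this.trans (le_of_eq ?_)
      ring
  refine (hc _).trans ?_
  calc c * ‖G z (fderiv ℝ (fderiv ℝ x) z w u)‖ ≤ c * (6 * C * y * (‖w‖ * ‖u‖)) := by gcongr
    _ = _ := by ring

/-- A vector field whose second derivatives are controlled by its `1`-jet vanishes near every zero
of its `1`-jet. -/
theorem eventually_eq_zero_of_norm_fderiv_fderiv_le {x : E → E} {z₀ : E} {C : ℝ}
    (hx : ContDiffAt ℝ 2 x z₀)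
    (hC : ∀ᶠ z in 𝓝 z₀, ‖fderiv ℝ (fderiv ℝ x) z‖ ≤ C * ‖(x z, fderiv ℝ x z)‖)
    (h0 : x z₀ = 0) (h1 : fderiv ℝ x z₀ = 0) : ∀ᶠ z in 𝓝 z₀, x z = 0 := by
  obtain ⟨ε, hε, hball⟩ := Metric.eventually_nhds_iff_ball.1 (hC.and (hx.eventually (by simp)))
  filter_upwards [Metric.ball_mem_nhds z₀ hε] with z hz
  let γ : ℝ → E := fun t => z₀ + t • (z - z₀)
  have hγ : ∀ t, HasDerivAt γ (z - z₀) t := fun t => by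
    have := ((hasDerivAt_id t).smul_const (z - z₀)).const_add z₀
    rwa [one_smul] at this
  have hmem : ∀ t ∈ Set.Icc (0 : ℝ) 1, γ t ∈ Metric.ball z₀ ε := fun t ht => by
    rw [mem_ball_iff_norm] at hz ⊢
    have : ‖γ t - z₀‖ = t * ‖z - z₀‖ := by simp [γ, norm_smul, abs_of_nonneg ht.1]
    rw [this]
    exact (mul_le_of_le_one_left (norm_nonneg _) ht.2).trans_lt hz
  let f : ℝ → E × (E →L[ℝ] E) := fun t => (x (γ t), fderiv ℝ x (γ t))
  let f' : ℝ → E × (E →L[ℝ] E) := fun t =>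
    (fderiv ℝ x (γ t) (z - z₀), fderiv ℝ (fderiv ℝ x) (γ t) (z - z₀))
  have hf : ∀ t ∈ Set.Icc (0 : ℝ) 1, HasDerivAt f (f' t) t := fun t ht => by
    have hxt := (hball _ (hmem t ht)).2
    have d1 := (hxt.differentiableAt (by simp)).hasFDerivAt
    have d2 := ((hxt.fderiv_right (m := 1) (by norm_num)).differentiableAt (by simp)).hasFDerivAt
    exact (d1.comp_hasDerivAt t (hγ t)).prodMk (d2.comp_hasDerivAt t (hγ t))
  -- A Grönwall-type estimate for the `1`-jet along the segment from `z₀` to `z`. In `max 1 C`, the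
  -- `1` serves the derivative of `x`, itself part of the jet, and `C` serves the second derivative.
  have hz0 := eq_zero_of_abs_deriv_le_mul_abs_self_of_eq_zero_right (f := f) (f' := f')
    (K := max 1 C * ‖z - z₀‖) (a := 0) (b := 1)
    (fun t ht => (hf t ht).continuousAt.continuousWithinAt)
    (fun t ht => (hf t ⟨ht.1, ht.2.le⟩).hasDerivWithinAt) (by simp [f, γ, h0, h1])
    (fun t ht => by
      have hb := (hball _ (hmem t ⟨ht.1, ht.2.le⟩)).1
      have hn : 0 ≤ ‖f t‖ := norm_nonneg _
      have e : max 1 C * ‖z - z₀‖ * ‖f t‖ = max 1 C * ‖f t‖ * ‖z - z₀‖ := by ring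
      rw [e]
      refine norm_prod_le_iff.2 ⟨?_, ?_⟩
      · refine (fderiv ℝ x (γ t)).le_of_opNorm_le ?_ _
        exact (norm_snd_le (f t)).trans (le_mul_of_one_le_left hn (le_max_left _ _))
      · refine (fderiv ℝ (fderiv ℝ x) (γ t)).le_of_opNorm_le (hb.trans ?_) _
        exact mul_le_mul_of_nonneg_right (le_max_right _ _) hn)
    1 (by simp)
  have : x (γ 1) = 0 := congrArg Prod.fst hz0
  simpa [γ] using this

end Flat

end KillingHorizons

/-! ### Vector fields, functions and brackets in charts. -/

namespace KillingHorizons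

open Bundle Set VectorField
open scoped Manifold ContDiff Topology

set_option linter.unusedSectionVars false

variable {E : Type*} [NormedAddCommGroup E] [NormedSpace ℝ E] [FiniteDimensional ℝ E]
  {M : Type*} [TopologicalSpace M] [ChartedSpace E M] [IsManifold 𝓘(ℝ, E) ∞ M]

theorem eventually_mem_chart_source (a : M) : ∀ᶠ b in 𝓝 a, b ∈ (chartAt E a).source :=
  chart_source_mem_nhds E a

theorem VField.contMDiffAt_coord' (Y : VField E M) {a b : M} (hb : b ∈ (chartAt E a).source) :
    ContMDiffAt 𝓘(ℝ, E) 𝓘(ℝ, E) ∞ (VField.coord a Y) b :=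
  ((trivializationAt E (fun x : M => TangentSpace 𝓘(ℝ, E) x) a).contMDiffAt_section_iff hb).1
    (Y.contMDiff b)

theorem VField.symm_coord (Y : VField E M) {a b : M} (hb : b ∈ (chartAt E a).source) :
    (trivializationAt E (fun x : M => TangentSpace 𝓘(ℝ, E) x) a).symm b (VField.coord a Y b) = Y b :=
  (trivializationAt E (fun x : M => TangentSpace 𝓘(ℝ, E) x) a).symm_apply_apply_mk (b := b) hb (Y b)

theorem VField.coord_eq_zero_iff (Y : VField E M) {a b : M} (hb : b ∈ (chartAt E a).source) :
    VField.coord a Y b = 0 ↔ Y b = 0 := by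
  have hz : ∀ Z : VField E M, Z b = 0 → VField.coord a Z b = 0 := fun Z h => by
    rw [coord_eq Z a b hb, h, map_zero]
    rfl
  refine ⟨fun h => ?_, hz Y⟩
  rw [← Y.symm_coord hb, h, ← hz 0 rfl, VField.symm_coord 0 hb]
  rfl

/-- There are vector fields on `M` that are constant in a given chart near a given point. -/
theorem exists_coord_eventually_eq [T2Space M] (a : M) (u : E) :
    ∃ Y : VField E M, ∀ᶠ b in 𝓝 a, VField.coord a Y b = u := by
  let t := trivializationAt E (fun x : M => TangentSpace 𝓘(ℝ, E) x) a
  let s : (x : M) → TangentSpace 𝓘(ℝ, E) x := fun x => t.symm x u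
  have hts : ∀ b ∈ (chartAt E a).source, (t ⟨b, s b⟩).2 = u := fun b hb =>
    congrArg Prod.snd (t.apply_mk_symm (b := b) hb u)
  have hs : CMDiff[(chartAt E a).source] ∞ (T% s) := by
    refine (t.contMDiffOn_section_baseSet_iff).2 ?_
    exact contMDiffOn_const.congr hts
  let χ : SmoothBumpFunction 𝓘(ℝ, E) a := Classical.arbitrary _
  refine ⟨⟨(fun x => χ x) • s, ContMDiffOn.smul_section_of_tsupport χ.contMDiff.contMDiffOn
    (chartAt E a).open_source χ.tsupport_subset_chartAt_source hs⟩, ?_⟩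
  filter_upwards [χ.eventuallyEq_one, eventually_mem_chart_source (E := E) a] with b hb hb'
  have : ((fun x => χ x) • s) b = s b := by
    change χ b • s b = s b
    rw [hb]
    exact one_smul ℝ (s b)
  change (t ⟨b, ((fun x => χ x) • s) b⟩).2 = u
  rw [this]
  exact hts b hb'

theorem exists_apply_eq [T2Space M] (a : M) (u : TangentSpace 𝓘(ℝ, E) a) :
    ∃ Y : VField E M, Y a = u := by
  obtain ⟨Y, hY⟩ := exists_coord_eventually_eq (E := E) a u
  exact ⟨Y, (coord_self Y a).symm.trans hY.self_of_nhds⟩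

/-- A vector field in the coordinates of the preferred chart at `a`. -/
noncomputable def VField.inChart (a : M) (X : VField E M) : E → E :=
  VField.coord a X ∘ (extChartAt 𝓘(ℝ, E) a).symm

theorem VField.inChart_apply (X : VField E M) {a b : M} (hb : b ∈ (chartAt E a).source) :
    VField.inChart a X (extChartAt 𝓘(ℝ, E) a b) = VField.coord a X b := by
  rw [VField.inChart, Function.comp_apply, (extChartAt 𝓘(ℝ, E) a).left_inv (by simpa using hb)]

theorem contDiffAt_comp_symm {F : Type*} [NormedAddCommGroup F] [NormedSpace ℝ F] {f : M → F}
    {a b : M} (hb : b ∈ (chartAt E a).source) (hf : ContMDiffAt 𝓘(ℝ, E) 𝓘(ℝ, F) ∞ f b) :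
    ContDiffAt ℝ ∞ (f ∘ (extChartAt 𝓘(ℝ, E) a).symm) (extChartAt 𝓘(ℝ, E) a b) := by
  have h := (contMDiffAt_iff_source_of_mem_source hb).1 hf
  rw [contMDiffWithinAt_iff_contDiffWithinAt] at h
  rwa [ModelWithCorners.Boundaryless.range_eq_univ, contDiffWithinAt_univ] at h

theorem mvfderiv_eq_fderiv {F : Type*} [NormedAddCommGroup F] [NormedSpace ℝ F] {f : M → F}
    {a b : M} (hb : b ∈ (chartAt E a).source) (hf : ContMDiffAt 𝓘(ℝ, E) 𝓘(ℝ, F) ∞ f b)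
    (X : VField E M) :
    mvfderiv 𝓘(ℝ, E) f b (X b) =
      fderiv ℝ (f ∘ (extChartAt 𝓘(ℝ, E) a).symm) (extChartAt 𝓘(ℝ, E) a b) (VField.coord a X b) := by
  have h1 := ((contDiffAt_comp_symm hb hf).differentiableAt (by simp)).hasFDerivAt.hasMFDerivAt
  have h2 := ((contMDiffAt_extChartAt' (I := 𝓘(ℝ, E)) (n := ∞) hb).mdifferentiableAt
    (by simp)).hasMFDerivAt
  have h3 := h1.comp b h2
  have e : f =ᶠ[𝓝 b] (f ∘ (extChartAt 𝓘(ℝ, E) a).symm) ∘ extChartAt 𝓘(ℝ, E) a := by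
    filter_upwards [(chartAt E a).open_source.mem_nhds hb] with c hc
    rw [Function.comp_apply, Function.comp_apply,
      (extChartAt 𝓘(ℝ, E) a).left_inv (by simpa using hc)]
  have h4 : mvfderiv 𝓘(ℝ, E) f b = _ := (h3.congr_of_eventuallyEq e).mfderiv
  rw [h4, coord_eq X a b hb]
  rfl

/-- Linear coordinates cut off by a bump function are global test functions, to which
`VField.deriv_bracket` applies. -/
theorem contMDiff_bump_smul_chart [T2Space M] (a : M) (χ : SmoothBumpFunction 𝓘(ℝ, E) a)
    (ℓ : E →L[ℝ] ℝ) : ContMDiff 𝓘(ℝ, E) 𝓘(ℝ, ℝ) ∞ (fun b : M => χ b • ℓ (extChartAt 𝓘(ℝ, E) a b)) :=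
  χ.contMDiff_smul (g := fun b => ℓ (extChartAt 𝓘(ℝ, E) a b))
    (ℓ.contMDiff.comp_contMDiffOn contMDiffOn_extChartAt)

/-- The derivative of a coordinate function along a vector field. -/
theorem eventually_mvfderiv_bump_smul_chart [T2Space M] (a : M) (χ : SmoothBumpFunction 𝓘(ℝ, E) a)
    (ℓ : E →L[ℝ] ℝ) : ∀ᶠ b in 𝓝 a, ∀ X : VField E M,
      mvfderiv 𝓘(ℝ, E) (fun b : M => χ b • ℓ (extChartAt 𝓘(ℝ, E) a b)) b (X b) =
        ℓ (VField.coord a X b) := by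
  filter_upwards [eventually_eventually_nhds.2 χ.eventuallyEq_one,
    eventually_mem_chart_source (E := E) a] with b hχ hb X
  have e : (fun b : M => χ b • ℓ (extChartAt 𝓘(ℝ, E) a b)) =ᶠ[𝓝 b]
      ℓ ∘ extChartAt 𝓘(ℝ, E) a := by
    filter_upwards [hχ] with c hc
    rw [hc]
    exact one_smul ℝ _
  have h2 := ((contMDiffAt_extChartAt' (I := 𝓘(ℝ, E)) (n := ∞) hb).mdifferentiableAt
    (by simp)).hasMFDerivAt
  have h3 := (ℓ.hasMFDerivAt (x := extChartAt 𝓘(ℝ, E) a b)).comp b h2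
  have h4 : mvfderiv 𝓘(ℝ, E) (fun b : M => χ b • ℓ (extChartAt 𝓘(ℝ, E) a b)) b = _ :=
    (h3.congr_of_eventuallyEq e).mfderiv
  rw [h4, coord_eq X a b hb]
  rfl

/-- The bracket in the coordinates of a chart. -/
theorem eventually_coord_lie [T2Space M] (X Y : VField E M) (a : M) : ∀ᶠ b in 𝓝 a,
    VField.coord a ⁅X, Y⁆ b =
      fderiv ℝ (VField.inChart a Y) (extChartAt 𝓘(ℝ, E) a b) (VField.coord a X b) -
        fderiv ℝ (VField.inChart a X) (extChartAt 𝓘(ℝ, E) a b) (VField.coord a Y b) := by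
  -- `bracket_coord` covers only the centre of the chart. At nearby points the bracket is recovered
  -- from its action on functions, tested on the finitely many coordinates of a basis.
  let χ : SmoothBumpFunction 𝓘(ℝ, E) a := Classical.arbitrary _
  have key : ∀ ℓ : E →L[ℝ] ℝ, ∀ᶠ b in 𝓝 a, ℓ (VField.coord a ⁅X, Y⁆ b) =
      ℓ (fderiv ℝ (VField.inChart a Y) (extChartAt 𝓘(ℝ, E) a b) (VField.coord a X b) -
        fderiv ℝ (VField.inChart a X) (extChartAt 𝓘(ℝ, E) a b) (VField.coord a Y b)) := by
    intro ℓ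
    filter_upwards [eventually_eventually_nhds.2 (eventually_mvfderiv_bump_smul_chart a χ ℓ),
      eventually_mem_chart_source (E := E) a] with b hb hbs
    have h := VField.deriv_bracket X Y (contMDiff_bump_smul_chart a χ ℓ) b
    have hd : ∀ Z W : VField E M, mvfderiv 𝓘(ℝ, E) (fun c => mvfderiv 𝓘(ℝ, E)
        (fun b : M => χ b • ℓ (extChartAt 𝓘(ℝ, E) a b)) c (Z c)) b (W b) =
        ℓ (fderiv ℝ (VField.inChart a Z) (extChartAt 𝓘(ℝ, E) a b) (VField.coord a W b)) := by
      intro Z W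
      have e : (fun c => mvfderiv 𝓘(ℝ, E) (fun b : M => χ b • ℓ (extChartAt 𝓘(ℝ, E) a b)) c (Z c))
          =ᶠ[𝓝 b] ℓ ∘ VField.coord a Z := hb.mono fun c hc => hc Z
      have hZ := Z.contMDiffAt_coord' hbs
      have hm : mvfderiv 𝓘(ℝ, E) (fun c => mvfderiv 𝓘(ℝ, E)
          (fun b : M => χ b • ℓ (extChartAt 𝓘(ℝ, E) a b)) c (Z c)) b =
          mvfderiv 𝓘(ℝ, E) (ℓ ∘ VField.coord a Z) b := e.mfderiv_eq
      rw [hm, mvfderiv_eq_fderiv hbs (ℓ.contMDiff.contMDiffAt.comp b hZ)]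
      have hf := ((contDiffAt_comp_symm hbs hZ).differentiableAt (by simp)).hasFDerivAt
      have hf' := (ℓ.hasFDerivAt.comp _ hf).fderiv
      rw [Function.comp_assoc, hf']
      rfl
    rw [hd, hd, hb.self_of_nhds] at h
    rw [h, map_sub]
  let B := Module.finBasis ℝ E
  filter_upwards [Filter.eventually_all.2 fun i => key (B.coord i).toContinuousLinearMap] with b hb
  exact B.ext_elem fun i => hb i

end KillingHorizons

/-! ### Unique continuation for Killing fields and finite dimension of `𝔨`. -/

namespace KillingHorizons

open Bundle Set VectorField
open scoped Manifold ContDiff Topology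

set_option linter.unusedSectionVars false

theorem IsLorentzForm.eq_zero_of_forall {V : Type*} [AddCommGroup V] [Module ℝ V]
    [TopologicalSpace V] {B : V →L[ℝ] V →L[ℝ] ℝ} (hB : IsLorentzForm B) {u : V}
    (hu : ∀ v, B u v = 0) : u = 0 := by
  obtain ⟨hs, t, -, ht⟩ := hB
  by_contra h
  exact (ht u (by rw [hs, hu]) h).ne' (hu u)

variable {E : Type*} [NormedAddCommGroup E] [NormedSpace ℝ E] [FiniteDimensional ℝ E]
  {M : Type*} [TopologicalSpace M] [ChartedSpace E M] [IsManifold 𝓘(ℝ, E) ∞ M]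

/-- The metric in the coordinates of the preferred chart at `a`, as a function on `M`. -/
noncomputable def LorentzMetric.coord (g : LorentzMetric E M) (a b : M) : E →L[ℝ] E →L[ℝ] ℝ :=
  ((trivializationAt (E →L[ℝ] E →L[ℝ] ℝ) (fun x : M => TangentSpace 𝓘(ℝ, E) x →L[ℝ]
    TangentSpace 𝓘(ℝ, E) x →L[ℝ] ℝ) a) (g.toSection b)).2

theorem LorentzMetric.apply_eq_coord (g : LorentzMetric E M) (Y Z : VField E M) {a b : M}
    (hb : b ∈ (chartAt E a).source) :
    g.toFun b (Y b) (Z b) = g.coord a b (VField.coord a Y b) (VField.coord a Z b) :=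
  eval_eq Y Z (g.toSection a) (g.toSection b) hb

set_option maxSynthPendingDepth 3 in
theorem LorentzMetric.contMDiffAt_coord (g : LorentzMetric E M) {a b : M}
    (hb : b ∈ (chartAt E a).source) :
    ContMDiffAt 𝓘(ℝ, E) 𝓘(ℝ, E →L[ℝ] E →L[ℝ] ℝ) ∞ (g.coord a) b :=
  ((trivializationAt (E →L[ℝ] E →L[ℝ] ℝ) (fun x : M => TangentSpace 𝓘(ℝ, E) x →L[ℝ]
    TangentSpace 𝓘(ℝ, E) x →L[ℝ] ℝ) a).contMDiffAt_section_iff (IB := 𝓘(ℝ, E)) (n := ∞)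
    (s := g.toFun) (x₀ := b) ⟨hb, hb, mem_univ b⟩).1 (g.contMDiff b)

/-- If `Y` vanishes at `a`, then `[V, Y]` at `a` is the derivative of `Y` along `V`. -/
theorem lie_apply_of_eq_zero (V : VField E M) {Y : VField E M} {a : M} (hY : Y a = 0) :
    ⁅V, Y⁆ a = Y.coordDeriv a (V a) := by
  rw [bracket_coord, hY, map_zero, sub_zero]
  rfl

theorem coordDeriv_eq_zero_of_eventually {Y : VField E M} {a : M} (hY : ∀ᶠ b in 𝓝 a, Y b = 0) :
    Y.coordDeriv a = 0 := by
  have e : VField.coord a Y =ᶠ[𝓝 a] fun _ => 0 := by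
    filter_upwards [hY, eventually_mem_chart_source (E := E) a] with b hb hbs
    exact (Y.coord_eq_zero_iff hbs).2 hb
  exact e.mfderiv_eq.trans mfderiv_const

theorem isClosed_setOf_eq_zero (Y : VField E M) : IsClosed {b : M | Y b = 0} := by
  rw [← isOpen_compl_iff, isOpen_iff_mem_nhds]
  intro b hb
  have hb' : VField.coord b Y b ≠ 0 := by
    rw [Ne, Y.coord_eq_zero_iff (mem_chart_source E b)]
    exact hb
  filter_upwards [(Y.contMDiffAt_coord b).continuousAt.eventually_ne hb',
    eventually_mem_chart_source (E := E) b] with c hc hcs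
  exact fun h => hc ((Y.coord_eq_zero_iff hcs).2 h)

theorem coordDeriv_eq_fderiv (X V : VField E M) (a : M) :
    X.coordDeriv a (V a) = fderiv ℝ (VField.inChart a X) (extChartAt 𝓘(ℝ, E) a a) (VField.coord a V a) :=
  mvfderiv_eq_fderiv (mem_chart_source E a) (X.contMDiffAt_coord a) V

/-- The Killing equation in the coordinates of a chart. -/
theorem eventually_flatKilling_eq_zero [T2Space M] {g : LorentzMetric E M} {X : VField E M}
    (hX : IsKilling g X) (a : M) (u v : E) : ∀ᶠ b in 𝓝 a,
      flatKilling (g.coord a ∘ (extChartAt 𝓘(ℝ, E) a).symm) (VField.inChart a X) u v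
        (extChartAt 𝓘(ℝ, E) a b) = 0 := by
  -- For test fields with constant coefficients near `a`, the bracket with `X` reduces to minus the
  -- derivative of `X` in the constant direction.
  obtain ⟨Y, hY⟩ := exists_coord_eventually_eq a u
  obtain ⟨Z, hZ⟩ := exists_coord_eventually_eq a v
  have hconst : ∀ (W : VField E M) (w : E), (∀ᶠ b in 𝓝 a, VField.coord a W b = w) → ∀ᶠ b in 𝓝 a,
      fderiv ℝ (VField.inChart a W) (extChartAt 𝓘(ℝ, E) a b) = 0 := by
    intro W w hW
    filter_upwards [eventually_eventually_nhds.2 hW, eventually_mem_chart_source (E := E) a]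
      with b hb hbs
    have hc : ContinuousAt (extChartAt 𝓘(ℝ, E) a).symm (extChartAt 𝓘(ℝ, E) a b) :=
      continuousAt_extChartAt_symm' (by simpa using hbs)
    have hl : (extChartAt 𝓘(ℝ, E) a).symm (extChartAt 𝓘(ℝ, E) a b) = b :=
      (extChartAt 𝓘(ℝ, E) a).left_inv (by simpa using hbs)
    rw [ContinuousAt, hl] at hc
    have e : VField.inChart a W =ᶠ[𝓝 (extChartAt 𝓘(ℝ, E) a b)] fun _ => w := hc.eventually hb
    rw [e.fderiv_eq]
    simp
  filter_upwards [eventually_eventually_nhds.2 hY, eventually_eventually_nhds.2 hZ, hconst Y u hY,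
    hconst Z v hZ, eventually_coord_lie X Y a, eventually_coord_lie X Z a,
    eventually_mem_chart_source (E := E) a] with b hYb hZb hY0 hZ0 hXY hXZ hb
  have h := hX Y Z b
  have hG := g.contMDiffAt_coord hb
  have e : (fun c => g.toFun c (Y c) (Z c)) =ᶠ[𝓝 b] fun c => g.coord a c u v := by
    filter_upwards [hYb, hZb, (chartAt E a).open_source.mem_nhds hb] with c hYc hZc hc
    rw [g.apply_eq_coord Y Z hc, hYc, hZc]
  have hGuv : ContMDiffAt 𝓘(ℝ, E) 𝓘(ℝ, ℝ) ∞ (fun c => g.coord a c u v) b :=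
    (hG.clm_apply contMDiffAt_const).clm_apply contMDiffAt_const
  have em : mvfderiv 𝓘(ℝ, E) (fun c => g.toFun c (Y c) (Z c)) b =
      mvfderiv 𝓘(ℝ, E) (fun c => g.coord a c u v) b := e.mfderiv_eq
  have hf := ((contDiffAt_comp_symm hb hG).differentiableAt (by simp)).hasFDerivAt
  have hf' := ((hf.clm_apply (hasFDerivAt_const u _)).clm_apply (hasFDerivAt_const v _)).fderiv
  have ed : fderiv ℝ ((fun c => g.coord a c u v) ∘ (extChartAt 𝓘(ℝ, E) a).symm)
      (extChartAt 𝓘(ℝ, E) a b) = _ := hf'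
  rw [em, mvfderiv_eq_fderiv hb hGuv X, g.apply_eq_coord _ _ hb, g.apply_eq_coord _ _ hb, hXY, hXZ,
    hY0, hZ0, hYb.self_of_nhds, hZb.self_of_nhds, ed] at h
  simp only [zero_apply, zero_sub, map_neg, neg_apply, ContinuousLinearMap.comp_zero, zero_add,
    ContinuousLinearMap.flip_apply] at h
  rw [flatKilling, VField.inChart_apply X hb, h, Function.comp_apply,
    (extChartAt 𝓘(ℝ, E) a).left_inv (by simpa using hb)]
  ring

theorem eventually_of_eventually_chart {a : M} {P : E → Prop}
    (h : ∀ᶠ b in 𝓝 a, P (extChartAt 𝓘(ℝ, E) a b)) : ∀ᶠ z in 𝓝 (extChartAt 𝓘(ℝ, E) a a), P z := by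
  have hc := continuousAt_extChartAt_symm (I := 𝓘(ℝ, E)) a
  rw [ContinuousAt, extChartAt_to_inv] at hc
  filter_upwards [hc.eventually h, extChartAt_target_mem_nhds (I := 𝓘(ℝ, E)) a] with z hz hzt
  rwa [(extChartAt 𝓘(ℝ, E) a).right_inv hzt] at hz

/-- The neighbourhood in `eventually_flatKilling_eq_zero` depends on `u` and `v`; bilinearity
reduces to finitely many pairs, so one neighbourhood serves all of them. -/
theorem flatKilling_eq_zero_of_basis {ι : Type*} (B : Module.Basis ι ℝ E)
    {G : E → E →L[ℝ] E →L[ℝ] ℝ} {x : E → E} {z : E}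
    (h : ∀ i j, flatKilling G x (B i) (B j) z = 0) (u v : E) : flatKilling G x u v z = 0 := by
  let Φ : E →ₗ[ℝ] E →ₗ[ℝ] ℝ := LinearMap.mk₂ ℝ (fun u v => flatKilling G x u v z)
    (fun _ _ _ => by simp only [flatKilling, map_add, add_apply]; ring)
    (fun _ _ _ => by simp only [flatKilling, map_smul, smul_apply, smul_eq_mul]; ring)
    (fun _ _ _ => by simp only [flatKilling, map_add]; ring)
    (fun _ _ _ => by simp only [flatKilling, map_smul, smul_eq_mul]; ring)
  have : Φ = 0 := B.ext fun i => B.ext fun j => h i j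
  exact congrArg (fun Ψ : E →ₗ[ℝ] E →ₗ[ℝ] ℝ => Ψ u v) this

/-- A Killing vector field whose `1`-jet vanishes at a point vanishes near this point. -/
theorem IsKilling.eventually_eq_zero [T2Space M] {g : LorentzMetric E M} {X : VField E M}
    (hX : IsKilling g X) {a : M} (h0 : X a = 0) (h1 : X.coordDeriv a = 0) :
    ∀ᶠ b in 𝓝 a, X b = 0 := by
  have ha := mem_chart_source E a
  have hleft : (extChartAt 𝓘(ℝ, E) a).symm (extChartAt 𝓘(ℝ, E) a a) = a := extChartAt_to_inv a
  let G : E → E →L[ℝ] E →L[ℝ] ℝ := g.coord a ∘ (extChartAt 𝓘(ℝ, E) a).symm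
  have hG : ContDiffAt ℝ 2 G (extChartAt 𝓘(ℝ, E) a a) :=
    (contDiffAt_comp_symm ha (g.contMDiffAt_coord ha)).of_le ENat.LEInfty.out
  have hx : ContDiffAt ℝ 2 (VField.inChart a X) (extChartAt 𝓘(ℝ, E) a a) :=
    (contDiffAt_comp_symm ha (X.contMDiffAt_coord a)).of_le ENat.LEInfty.out
  let B := Module.finBasis ℝ E
  have hK : ∀ᶠ z in 𝓝 (extChartAt 𝓘(ℝ, E) a a), ∀ u v,
      flatKilling G (VField.inChart a X) u v z = 0 := by
    refine eventually_of_eventually_chart ?_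
    filter_upwards [Filter.eventually_all.2 fun i => Filter.eventually_all.2 fun j =>
      eventually_flatKilling_eq_zero hX a (B i) (B j)] with b hb
    exact flatKilling_eq_zero_of_basis B hb
  have hs : ∀ᶠ z in 𝓝 (extChartAt 𝓘(ℝ, E) a a), ∀ u v, G z u v = G z v u := by
    refine eventually_of_eventually_chart ?_
    choose Y hY using fun i => exists_coord_eventually_eq a (B i)
    filter_upwards [Filter.eventually_all.2 hY, eventually_mem_chart_source (E := E) a] with b hb hbs
    have hl : (extChartAt 𝓘(ℝ, E) a).symm (extChartAt 𝓘(ℝ, E) a b) = b :=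
      (extChartAt 𝓘(ℝ, E) a).left_inv (by simpa using hbs)
    have hG' : G (extChartAt 𝓘(ℝ, E) a b) = g.coord a b := congrArg (g.coord a) hl
    rw [hG']
    have e : (ContinuousLinearMap.toLinearMap₁₂ (g.coord a b)) =
        (ContinuousLinearMap.toLinearMap₁₂ (g.coord a b)).flip := by
      refine B.ext fun i => B.ext fun j => ?_
      change g.coord a b (B i) (B j) = g.coord a b (B j) (B i)
      rw [← hb i, ← hb j, ← g.apply_eq_coord _ _ hbs, ← g.apply_eq_coord _ _ hbs]
      exact (g.isLorentz b).1 _ _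
    exact fun u v => congrArg (fun Ψ : E →ₗ[ℝ] E →ₗ[ℝ] ℝ => Ψ u v) e
  have hn : ∀ u, (∀ v, G (extChartAt 𝓘(ℝ, E) a a) u v = 0) → u = 0 := by
    intro u hu
    have hG' : G (extChartAt 𝓘(ℝ, E) a a) = g.coord a a := congrArg (g.coord a) hleft
    obtain ⟨Y, hY⟩ := exists_coord_eventually_eq a u
    rw [hG'] at hu
    have : Y a = 0 := (g.isLorentz a).eq_zero_of_forall fun v => by
      obtain ⟨Z, rfl⟩ := exists_apply_eq a v
      rw [g.apply_eq_coord Y Z ha, hY.self_of_nhds, hu]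
    rw [← hY.self_of_nhds, Y.coord_eq_zero_iff ha, this]
  obtain ⟨C, hC⟩ := exists_norm_fderiv_fderiv_le hG hx hn hs hK
  have hz := eventually_eq_zero_of_norm_fderiv_fderiv_le hx hC
    (by rw [VField.inChart_apply X ha, X.coord_eq_zero_iff ha, h0]) (by
      ext u
      obtain ⟨Y, hY⟩ := exists_coord_eventually_eq a u
      have := coordDeriv_eq_fderiv X Y a
      rw [h1, hY.self_of_nhds] at this
      exact this.symm)
  filter_upwards [(continuousAt_extChartAt (I := 𝓘(ℝ, E)) a).eventually hz,
    eventually_mem_chart_source (E := E) a] with b hb hbs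
  rwa [VField.inChart_apply X hbs, X.coord_eq_zero_iff hbs] at hb

/-- A Killing vector field on a connected manifold is determined by its `1`-jet at a point. -/
theorem IsKilling.eq_zero [T2Space M] [ConnectedSpace M] {g : LorentzMetric E M} {X : VField E M}
    (hX : IsKilling g X) {a : M} (h0 : X a = 0) (h1 : X.coordDeriv a = 0) : X = 0 := by
  let S : Set M := {b | ∀ᶠ c in 𝓝 b, X c = 0}
  have hopen : IsOpen S := isOpen_setOfPred_eventually_nhds
  have hS : ∀ b ∈ S, X b = 0 := fun b hb => by
    have hb' : ∀ᶠ c in 𝓝 b, X c = 0 := hb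
    exact hb'.self_of_nhds
  have hclosed : IsClosed S := by
    refine isClosed_of_closure_subset fun b hb => ?_
    have hb0 : X b = 0 := closure_minimal hS (isClosed_setOf_eq_zero X) hb
    refine hX.eventually_eq_zero hb0 ?_
    ext u
    obtain ⟨V, hV⟩ := exists_apply_eq b u
    -- Closedness for the derivative: `[V, X]` is a vector field vanishing on `S`, hence on the
    -- closure, and at a zero of `X` it is the derivative of `X` along `V`.
    have hVX : ⁅V, X⁆ b = 0 := by
      refine closure_minimal (fun c hc => ?_) (isClosed_setOf_eq_zero ⁅V, X⁆) hb
      change ⁅V, X⁆ c = 0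
      rw [lie_apply_of_eq_zero V (hS c hc), coordDeriv_eq_zero_of_eventually hc]
      rfl
    rw [lie_apply_of_eq_zero V hb0, hV] at hVX
    exact hVX
  have huniv : S = univ := IsClopen.eq_univ ⟨hclosed, hopen⟩ ⟨a, hX.eventually_eq_zero h0 h1⟩
  ext b
  exact hS b (huniv ▸ mem_univ b)

/-- The Lie algebra of Killing vector fields on a connected manifold is finite-dimensional. -/
instance finiteDimensional_killingAlgebra [T2Space M] [ConnectedSpace M] (g : LorentzMetric E M) :
    FiniteDimensional ℝ (killingAlgebra g) := by
  obtain ⟨a⟩ := (inferInstance : Nonempty M)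
  let B := Module.finBasis ℝ E
  choose V hV using fun i => exists_apply_eq (E := E) a (B i)
  -- The brackets with the `V i` stand in for the derivative of `X` at `a`; they agree with it on
  -- fields that vanish at `a`, which is all that injectivity needs.
  let Φ : killingAlgebra g →ₗ[ℝ] E × (Fin (Module.finrank ℝ E) → E) :=
    { toFun := fun X => ((X : VField E M) a, fun i => ⁅V i, (X : VField E M)⁆ a)
      map_add' := fun X Y => Prod.ext rfl (funext fun i =>
        congrArg (fun W : VField E M => (W a : E)) (lie_add (V i) (X : VField E M) Y))
      map_smul' := fun c X => Prod.ext rfl (funext fun i =>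
        congrArg (fun W : VField E M => (W a : E)) (lie_smul c (V i) (X : VField E M))) }
  refine FiniteDimensional.of_injective Φ (LinearMap.ker_eq_bot.1 (LinearMap.ker_eq_bot'.2 ?_))
  intro X hX
  have h0 : (X : VField E M) a = 0 := congrArg Prod.fst hX
  refine Subtype.ext (IsKilling.eq_zero X.2 h0 ?_)
  have h : ((X : VField E M).coordDeriv a).toLinearMap = 0 := B.ext fun i => by
    have h1 : ⁅V i, (X : VField E M)⁆ a = 0 := congrFun (congrArg Prod.snd hX) i
    rw [lie_apply_of_eq_zero _ h0, hV] at h1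
    exact h1
  ext u
  exact congrArg (fun Ψ : E →ₗ[ℝ] E => Ψ u) h

end KillingHorizons

/-! ### Lorentzian linear algebra and the surface gravity equation. -/

namespace KillingHorizons

open Bundle Set VectorField
open scoped Manifold ContDiff Topology

set_option linter.unusedSectionVars false

section LinearAlgebra

variable {V : Type*} [AddCommGroup V] [Module ℝ V]

/-- In a Lorentzian vector space, orthogonal null vectors are proportional. -/
theorem IsLorentzForm.exists_eq_smul_of_null [TopologicalSpace V] {B : V →L[ℝ] V →L[ℝ] ℝ}
    (hB : IsLorentzForm B) {n w : V} (hn : n ≠ 0) (hnn : B n n = 0) (hww : B w w = 0)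
    (hnw : B n w = 0) : ∃ c : ℝ, w = c • n := by
  obtain ⟨hs, t, -, ht⟩ := hB
  have htn : B t n ≠ 0 := fun h => (ht n h hn).ne' hnn
  -- The coefficient making `w - c n` orthogonal to the timelike vector `t`. That difference is
  -- null, yet the form is positive definite on the complement of `t`.
  refine ⟨B t w / B t n, ?_⟩
  by_contra h
  have h0 : B t (w - (B t w / B t n) • n) = 0 := by
    rw [map_sub, map_smul, smul_eq_mul, div_mul_cancel₀ _ htn, sub_self]
  refine (ht _ h0 (sub_ne_zero.2 h)).ne' ?_
  simp [hnn, hww, hnw, hs w n]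

theorem exists_eq_add_smul_of_finrank_add_one [FiniteDimensional ℝ V] {T : Submodule ℝ V}
    (hT : Module.finrank ℝ T + 1 = Module.finrank ℝ V) {v : V} (hv : v ∉ T) (w : V) :
    ∃ t ∈ T, ∃ c : ℝ, w = t + c • v := by
  have h1 : Module.finrank ℝ (V ⧸ T) = 1 := by
    have := T.finrank_quotient_add_finrank
    lia
  have hv' : T.mkQ v ≠ 0 := by
    rwa [Submodule.mkQ_apply, Ne, Submodule.Quotient.mk_eq_zero]
  obtain ⟨c, hc⟩ := (finrank_eq_one_iff_of_nonzero' _ hv').1 h1 (T.mkQ w)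
  refine ⟨w - c • v, ?_, c, by abel⟩
  rw [← Submodule.Quotient.mk_eq_zero, ← Submodule.mkQ_apply, map_sub, map_smul, hc, sub_self]

/-- Linear forms that vanish on a hyperplane are proportional. -/
theorem mul_eq_mul_of_vanish_on_hyperplane [FiniteDimensional ℝ V] {T : Submodule ℝ V}
    (hT : Module.finrank ℝ T + 1 = Module.finrank ℝ V) {α β : V →ₗ[ℝ] ℝ} (hα : ∀ v ∈ T, α v = 0)
    (hβ : ∀ v ∈ T, β v = 0) (v w : V) : α v * β w = α w * β v := by
  by_cases hv : v ∈ T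
  · rw [hα v hv, hβ v hv, zero_mul, mul_zero]
  · obtain ⟨t, ht, c, rfl⟩ := exists_eq_add_smul_of_finrank_add_one hT hv w
    rw [map_add, map_add, map_smul, map_smul, hα t ht, hβ t ht, smul_eq_mul, smul_eq_mul]
    ring

/-- An endomorphism that is skew for a nondegenerate form and vanishes on a hyperplane is zero. -/
theorem IsLorentzForm.eq_zero_of_skew [FiniteDimensional ℝ V] [TopologicalSpace V]
    {B : V →L[ℝ] V →L[ℝ] ℝ} (hB : IsLorentzForm B) {T : Submodule ℝ V}
    (hT : Module.finrank ℝ T + 1 = Module.finrank ℝ V) {A : V →ₗ[ℝ] V}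
    (hA : ∀ v w, B (A v) w + B v (A w) = 0) (hAT : ∀ v ∈ T, A v = 0) (u : V) : A u = 0 := by
  by_cases hu : u ∈ T
  · exact hAT u hu
  refine hB.eq_zero_of_forall fun w => ?_
  obtain ⟨t, ht, c, rfl⟩ := exists_eq_add_smul_of_finrank_add_one hT hu w
  have h1 := hA u t
  have h2 := hA u u
  rw [hAT t ht, map_zero, add_zero] at h1
  rw [hB.1 u] at h2
  rw [map_add, map_smul, h1, smul_eq_mul, zero_add]
  have : B (A u) u = 0 := by linarith
  rw [this, mul_zero]

end LinearAlgebra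

variable {E : Type*} [NormedAddCommGroup E] [NormedSpace ℝ E] [FiniteDimensional ℝ E]
  {M : Type*} [TopologicalSpace M] [ChartedSpace E M] [IsManifold 𝓘(ℝ, E) ∞ M]

theorem LorentzMetric.mdifferentiableAt_apply (g : LorentzMetric E M) (Y Z : VField E M) (a : M) :
    MDiffAt (fun b => g.toFun b (Y b) (Z b)) a :=
  (g.contMDiff_apply Y Z a).mdifferentiableAt (by simp)

theorem VField.sub_smul_apply (Y K : VField E M) (c : ℝ) (a : M) :
    (Y - c • K) a = Y a - c • K a := rfl

/-- If `Y` vanishes at `a`, then `V g(Y, W) = g([V, Y], W)` at `a`. -/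
theorem mvfderiv_metric_of_eq_zero (g : LorentzMetric E M) (V W : VField E M) {Y : VField E M} {a : M}
    (hY : Y a = 0) :
    mvfderiv 𝓘(ℝ, E) (fun b => g.toFun b (Y b) (W b)) a (V a) = g.toFun a (⁅V, Y⁆ a) (W a) := by
  have ha := mem_chart_source E a
  have e : (fun b => g.toFun b (Y b) (W b)) =ᶠ[𝓝 a]
      fun b => g.coord a b (VField.coord a Y b) (VField.coord a W b) :=
    (eventually_mem_chart_source (E := E) a).mono fun b hb => g.apply_eq_coord Y W hb
  obtain ⟨D, hD, hDv⟩ := hasMFDerivAt_clm2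
    ((g.contMDiffAt_coord ha).mdifferentiableAt (by simp)).hasMFDerivAt
    (coord_mdiff Y a).hasMFDerivAt (coord_mdiff W a).hasMFDerivAt
  have h1 : mvfderiv 𝓘(ℝ, E) (fun b => g.toFun b (Y b) (W b)) a = D :=
    (hD.congr_of_eventuallyEq e).mfderiv
  rw [h1, g.apply_eq_coord _ _ ha, coord_self ⁅V, Y⁆, lie_apply_of_eq_zero V hY]
  refine (hDv _).trans ?_
  have hY0 : VField.coord a Y a = 0 := (coord_self Y a).trans hY
  rw [hY0, map_zero, map_zero, zero_apply, zero_apply, zero_add, add_zero]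
  rfl

/-- The derivative of a Killing vector field at a zero is skew. -/
theorem IsKilling.skew_of_eq_zero {g : LorentzMetric E M} {Y : VField E M} (hY : IsKilling g Y) {a : M}
    (h0 : Y a = 0) (V W : VField E M) :
    g.toFun a (⁅V, Y⁆ a) (W a) + g.toFun a (V a) (⁅W, Y⁆ a) = 0 := by
  have h := hY V W a
  have hs : ∀ U : VField E M, ⁅Y, U⁆ a = -⁅U, Y⁆ a := fun U =>
    congrArg (fun Z : VField E M => Z a) (lie_skew Y U).symm
  rw [h0, map_zero, hs, hs, map_neg, map_neg, neg_apply] at h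
  linarith

theorem IsKilling.mvfderiv_metric_of_eq_zero {g : LorentzMetric E M} {Y : VField E M}
    (hY : IsKilling g Y) {a : M} (h0 : Y a = 0) (V W : VField E M) :
    mvfderiv 𝓘(ℝ, E) (fun b => g.toFun b (Y b) (W b)) a (V a) = -g.toFun a (V a) (⁅W, Y⁆ a) := by
  rw [KillingHorizons.mvfderiv_metric_of_eq_zero g V W h0]
  linarith [hY.skew_of_eq_zero h0 V W]

/-- The bracket at a point where two vector fields are multiples of a third one. -/
theorem lie_apply_of_eq_smul {X Y K : VField E M} {a : M} {x y : ℝ} (hX : X a = x • K a)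
    (hY : Y a = y • K a) : ⁅X, Y⁆ a = x • ⁅K, Y⁆ a - y • ⁅K, X⁆ a := by
  have hY0 : (Y - y • K) a = 0 := by rw [VField.sub_smul_apply, hY, sub_self]
  have hX0 : (X - x • K) a = 0 := by rw [VField.sub_smul_apply, hX, sub_self]
  -- Both differences vanish at `a`, hence so does their bracket; expanding it gives the formula.
  have h := lie_apply_of_eq_zero (X - x • K) hY0
  rw [hX0] at h
  replace h := h.trans (map_zero ((Y - y • K).coordDeriv a : E →L[ℝ] E))
  have e : ⁅X - x • K, Y - y • K⁆ = ⁅X, Y⁆ - (x • ⁅K, Y⁆ - y • ⁅K, X⁆) := by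
    rw [sub_lie, lie_sub, lie_sub, smul_lie, smul_lie, lie_smul, lie_smul, lie_self, ← lie_skew X K]
    module
  rw [e] at h
  exact sub_eq_zero.1 h

/-- Let `K` be a Killing vector field for which `d(g(K, K))` and `g(K, ·)` are proportional at `a`.
On the Killing vector fields `X` such that `X`, `[K, X]` and `[K, [K, X]]` are multiples of `K` at
`a`, the map `ad K` acts at `a` as an operator with a fixed eigenvalue. -/
theorem exists_lie_lie_eq_smul [T2Space M] {g : LorentzMetric E M} {K : VField E M}
    (hK : IsKilling g K) {a : M} (hne : K a ≠ 0)
    (hprop : ∀ v w, mvfderiv 𝓘(ℝ, E) (fun b => g.toFun b (K b) (K b)) a v * g.toFun a (K a) w =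
      mvfderiv 𝓘(ℝ, E) (fun b => g.toFun b (K b) (K b)) a w * g.toFun a (K a) v) :
    ∃ κ : ℝ, ∀ X : VField E M, IsKilling g X → (∃ c : ℝ, X a = c • K a) →
      (∃ c : ℝ, ⁅K, X⁆ a = c • K a) → (∃ c : ℝ, ⁅K, ⁅K, X⁆⁆ a = c • K a) →
      ⁅K, ⁅K, X⁆⁆ a = κ • ⁅K, X⁆ a := by
  obtain ⟨V, hV⟩ : ∃ V : VField E M, g.toFun a (K a) (V a) ≠ 0 := by
    by_contra! h
    refine hne ((g.isLorentz a).eq_zero_of_forall fun v => ?_)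
    obtain ⟨V, rfl⟩ := exists_apply_eq a v
    exact h V
  set φ : M → ℝ := fun b => g.toFun b (K b) (K b) with hφ
  have hφs : CMDiff ∞ φ := g.contMDiff_apply K K
  set α := mvfderiv 𝓘(ℝ, E) φ a with hα
  -- The factor in `d(g(K, K)) = 2κ g(K, ·)` at `a`, the surface gravity up to sign when `a` lies on
  -- a horizon. It does not depend on `X`.
  refine ⟨α (V a) / (2 * g.toFun a (K a) (V a)), ?_⟩
  rintro X hX ⟨x, hx⟩ ⟨z, hz⟩ ⟨q, hq⟩
  -- derivatives of `V φ` and `g(K, V)` along `K` and `X`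
  have hVφ : ∀ Z : VField E M, mvfderiv 𝓘(ℝ, E) (fun b => mvfderiv 𝓘(ℝ, E) φ b (V b)) a (Z a) =
      α (⁅Z, V⁆ a) + mvfderiv 𝓘(ℝ, E) (fun b => mvfderiv 𝓘(ℝ, E) φ b (Z b)) a (V a) := fun Z => by
    rw [hα, VField.deriv_bracket Z V hφs a]
    ring
  have hZφ : ∀ Z : VField E M, IsKilling g Z → (fun b => mvfderiv 𝓘(ℝ, E) φ b (Z b)) =
      (2 : ℝ) • fun b => g.toFun b (⁅Z, K⁆ b) (K b) := fun Z hZ => by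
    funext b
    rw [hφ, hZ K K b, (g.isLorentz b).1 (K b)]
    exact (two_mul _).symm
  have hVZφ : ∀ Z : VField E M, IsKilling g Z →
      mvfderiv 𝓘(ℝ, E) (fun b => mvfderiv 𝓘(ℝ, E) φ b (Z b)) a (V a) =
      2 * mvfderiv 𝓘(ℝ, E) (fun b => g.toFun b (⁅Z, K⁆ b) (K b)) a (V a) := fun Z hZ => by
    rw [hZφ Z hZ]
    have := const_smul_mfderiv (I := 𝓘(ℝ, E)) (g.mdifferentiableAt_apply ⁅Z, K⁆ K a) (2 : ℝ)
    exact congrArg (fun D : E →L[ℝ] ℝ => D (V a)) this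
  have hKK : mvfderiv 𝓘(ℝ, E) (fun b => g.toFun b (⁅K, K⁆ b) (K b)) a (V a) = 0 := by
    rw [lie_self, mvfderiv_metric_of_eq_zero g V K (Y := 0) rfl, lie_zero]
    exact congrArg (fun D : E →L[ℝ] ℝ => D (K a)) (map_zero (g.toFun a))
  have hK1 := hVφ K
  rw [hVZφ K hK, hKK, mul_zero, add_zero] at hK1
  have hK2 := hK K V a
  rw [lie_self] at hK2
  have h00 : g.toFun a ((0 : VField E M) a) (V a) = 0 :=
    congrArg (fun D : E →L[ℝ] ℝ => D (V a)) (map_zero (g.toFun a))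
  rw [h00, zero_add] at hK2
  have hX1 := hVφ X
  rw [hVZφ X hX, hx, map_smul, hK1, smul_eq_mul] at hX1
  have hX2 := hX K V a
  rw [hx, map_smul, hK2, smul_eq_mul] at hX2
  have hXK : ⁅X, K⁆ = -⁅K, X⁆ := (lie_skew X K).symm
  have p1 := hprop (⁅K, V⁆ a) (V a)
  have p2 := hprop (⁅X, V⁆ a) (V a)
  have hXKa : ⁅X, K⁆ a = -(z • K a) := by
    rw [← hz, hXK]
    rfl
  have hβ : g.toFun a (⁅X, K⁆ a) (V a) = -(z * g.toFun a (K a) (V a)) := by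
    rw [hXKa, map_neg, map_smul, neg_apply, smul_apply, smul_eq_mul]
  rw [hβ] at hX2
  -- the Killing vector field `[X, K] + z K` vanishes at `a`
  set Y : VField E M := ⁅X, K⁆ - (-z) • K with hYdef
  have hYK : IsKilling g Y := (killingAlgebra g).sub_mem
    ((killingAlgebra g).lie_mem hX hK) ((killingAlgebra g).smul_mem (-z) hK)
  have hY0 : Y a = 0 := by
    rw [hYdef, VField.sub_smul_apply, hXKa, neg_smul, sub_self]
  have hY1 := hYK.mvfderiv_metric_of_eq_zero hY0 V K
  have hKY : ⁅K, Y⁆ = -⁅K, ⁅K, X⁆⁆ := by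
    rw [hYdef, lie_sub, lie_smul, lie_self, smul_zero, sub_zero, hXK, lie_neg]
  have hKYa : ⁅K, Y⁆ a = -(q • K a) := by
    rw [← hq, hKY]
    rfl
  have hY2 : mvfderiv 𝓘(ℝ, E) (fun b => g.toFun b (Y b) (K b)) a (V a) =
      mvfderiv 𝓘(ℝ, E) (fun b => g.toFun b (⁅X, K⁆ b) (K b)) a (V a) + z * α (V a) := by
    have e : (fun b => g.toFun b (Y b) (K b)) =
        (fun b => g.toFun b (⁅X, K⁆ b) (K b)) + z • φ := by
      funext b
      rw [hYdef, VField.sub_smul_apply, map_sub, map_smul, sub_apply, smul_apply, neg_smul,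
        sub_neg_eq_add]
      rfl
    have hd := mvfderiv_add (g.mdifferentiableAt_apply ⁅X, K⁆ K a)
      ((g.mdifferentiableAt_apply K K a).const_smul z)
    rw [e]
    refine (congrArg (fun D : E →L[ℝ] ℝ => D (V a)) hd).trans ?_
    refine congrArg₂ (fun s t : ℝ => s + t) rfl ?_
    exact congrArg (fun D : E →L[ℝ] ℝ => D (V a))
      (const_smul_mfderiv (I := 𝓘(ℝ, E)) (g.mdifferentiableAt_apply K K a) z)
  rw [hY1, hKYa, map_neg, map_smul, neg_neg, smul_eq_mul, (g.isLorentz a).1 (V a)] at hY2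
  rw [hq, hz, smul_smul]
  congr 1
  set m := mvfderiv 𝓘(ℝ, E) (fun b => g.toFun b (⁅X, K⁆ b) (K b)) a (V a)
  set β := g.toFun a (K a) (V a)
  -- `V φ` and `g(K, V)` have each been differentiated along `X` and along `K`, and `X = xK` at `a`.
  -- Proportionality of `α` and `g(K, ·)` at `[K, V]` and at `[X, V]` eliminates both brackets.
  have h2m : (2 * m + z * α (V a)) * β = 0 := by
    linear_combination (-β) * hX1 + α (V a) * hX2 + x * p1 - p2
  have h2m' : 2 * m + z * α (V a) = 0 := (mul_eq_zero.1 h2m).resolve_right hV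
  field_simp
  linear_combination 2 * hY2 + h2m'

end KillingHorizons

/-! ### Invariant Killing horizons. -/

namespace KillingHorizons

open Bundle Set VectorField
open scoped Manifold ContDiff Topology

set_option linter.unusedSectionVars false

variable {E : Type*} [NormedAddCommGroup E] [NormedSpace ℝ E] [FiniteDimensional ℝ E]
  {M : Type*} [TopologicalSpace M] [ChartedSpace E M] [IsManifold 𝓘(ℝ, E) ∞ M]

theorem coe_eq_sum_repr {g : LorentzMetric E M} {r : ℕ}
    (b : Module.Basis (Fin r) ℝ (radicalAbelianIdeal (killingAlgebra g))) {K : Fin r → VField E M}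
    (hK : ∀ i, K i = ((b i : killingAlgebra g) : VField E M))
    (Y : radicalAbelianIdeal (killingAlgebra g)) :
    ((Y : killingAlgebra g) : VField E M) = ∑ i, b.repr Y i • K i := by
  have h1 := congrArg (fun Z : radicalAbelianIdeal (killingAlgebra g) =>
    ((killingAlgebra g).incl : killingAlgebra g →ₗ[ℝ] VField E M)
      ((radicalAbelianIdeal (killingAlgebra g)).incl Z)) (b.sum_repr Y)
  simp only [map_sum, map_smul] at h1
  refine h1.symm.trans (Finset.sum_congr rfl fun i _ => ?_)
  rw [hK]
  rfl

section Horizon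

variable {E' : Type*} [NormedAddCommGroup E'] [NormedSpace ℝ E'] [FiniteDimensional ℝ E']
  {N : Type*} [TopologicalSpace N] [ChartedSpace E' N] [IsManifold 𝓘(ℝ, E') ∞ N]
  {g : LorentzMetric E M} {ι : N → M}

theorem IsHypersurface.finrank_tangent (h : IsHypersurface (E := E) (E' := E') ι) (p : N) :
    Module.finrank ℝ (hypersurfaceTangent (E := E) (E' := E') ι p) + 1 =
      Module.finrank ℝ (TangentSpace 𝓘(ℝ, E) (ι p)) := by
  refine Eq.trans (congrArg (· + 1) ?_) h.finrank_eq
  exact LinearMap.finrank_range_of_inj (M := E') (N := E) (h.injective_mfderiv p)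

/-- The derivative in a tangent direction of a function that vanishes along a hypersurface. -/
theorem mvfderiv_eq_zero_of_tangent {F : Type*} [NormedAddCommGroup F] [NormedSpace ℝ F] {f : M → F}
    {p : N} (hι : MDifferentiableAt 𝓘(ℝ, E') 𝓘(ℝ, E) ι p) (hf : MDiffAt f (ι p))
    (h0 : ∀ᶠ q in 𝓝 p, f (ι q) = 0) {v : TangentSpace 𝓘(ℝ, E) (ι p)}
    (hv : v ∈ hypersurfaceTangent (E := E) (E' := E') ι p) : mvfderiv 𝓘(ℝ, E) f (ι p) v = 0 := by
  obtain ⟨w, rfl⟩ := hv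
  have h1 := (hf.hasMFDerivAt.comp p hι.hasMFDerivAt).mfderiv
  have e : f ∘ ι =ᶠ[𝓝 p] fun _ => (0 : F) := h0
  have h2 : mfderiv 𝓘(ℝ, E') 𝓘(ℝ, F) (f ∘ ι) p = 0 := e.mfderiv_eq.trans mfderiv_const
  exact congrArg (fun D : E' →L[ℝ] F => D w) (h1.symm.trans h2)

/-- `K` is a Killing vector field that is null, tangent and nonzero along `ι`. -/
structure IsGenerator (g : LorentzMetric E M) (ι : N → M) (K : VField E M) : Prop where
  isHypersurface : IsHypersurface (E := E) (E' := E') ι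
  isKilling : IsKilling g K
  null : ∀ p, g.toFun (ι p) (K (ι p)) (K (ι p)) = 0
  ne_zero : ∀ p, K (ι p) ≠ 0
  orthogonal : ∀ p, ∀ v ∈ hypersurfaceTangent (E := E) (E' := E') ι p, g.toFun (ι p) (K (ι p)) v = 0

/-- The degenerate direction `n` of the induced metric is normal to `H`. A null tangent vector is
orthogonal to `n`, hence a multiple of `n`, so the generator is normal too. -/
theorem IsKillingHorizon.exists_isGenerator (h : IsKillingHorizon (E' := E') g ι) :
    ∃ K, IsGenerator (E' := E') g ι K := by
  obtain ⟨K, hK, hKp⟩ := h.exists_generator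
  refine ⟨K, h.isHypersurface, hK, fun p => (hKp p).1, fun p => (hKp p).2.2, fun p v hv => ?_⟩
  obtain ⟨n, hnT, hn, hnv⟩ := h.isNull p
  obtain ⟨c, hc⟩ := (g.isLorentz (ι p)).exists_eq_smul_of_null hn (hnv n hnT) (hKp p).1
    (hnv _ (hKp p).2.1)
  rw [hc, map_smul, smul_apply, hnv v hv, smul_zero]

variable {K : VField E M}

theorem IsGenerator.mdifferentiableAt (h : IsGenerator (E' := E') g ι K) (p : N) :
    MDifferentiableAt 𝓘(ℝ, E') 𝓘(ℝ, E) ι p :=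
  (h.isHypersurface.contMDiff p).mdifferentiableAt (by simp)

theorem IsGenerator.exists_eq_smul (h : IsGenerator (E' := E') g ι K) {p : N}
    {v : TangentSpace 𝓘(ℝ, E) (ι p)} (hv : v ∈ hypersurfaceTangent (E := E) (E' := E') ι p)
    (hvv : g.toFun (ι p) v v = 0) : ∃ c : ℝ, v = c • K (ι p) :=
  (g.isLorentz (ι p)).exists_eq_smul_of_null (h.ne_zero p) (h.null p) hvv (h.orthogonal p v hv)

/-- If a Killing vector field is a multiple of the generator along the horizon, then so are its
brackets with all Killing vector fields. -/
theorem IsGenerator.exists_lie_eq_smul (h : IsGenerator (E' := E') g ι K)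
    (hinv : IsKillingInvariant (E' := E') g ι) {X Z : VField E M} (hX : X ∈ killingAlgebra g)
    (hXK : ∀ p, ∃ c : ℝ, X (ι p) = c • K (ι p)) (hZ : Z ∈ killingAlgebra g) (p : N) :
    ∃ c : ℝ, ⁅Z, X⁆ (ι p) = c • K (ι p) := by
  have hZX := (killingAlgebra g).lie_mem hZ hX
  have hZZX := (killingAlgebra g).lie_mem hZ hZX
  have hXv : ∀ q, ∀ v ∈ hypersurfaceTangent (E := E) (E' := E') ι q, g.toFun (ι q) (X (ι q)) v = 0 := by
    intro q v hv
    obtain ⟨c, hc⟩ := hXK q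
    rw [hc, map_smul, smul_apply, h.orthogonal q v hv, smul_zero]
  refine h.exists_eq_smul (hinv _ hZX p) ?_
  have h1 : ∀ q, g.toFun (ι q) (⁅Z, X⁆ (ι q)) (X (ι q)) = 0 := fun q => by
    rw [(g.isLorentz _).1]
    exact hXv q _ (hinv _ hZX q)
  -- Differentiate `g([Z, X], X) = 0` along `Z`, which is tangent by invariance. The term with `[Z,
  -- [Z, X]]` vanishes because `X` is normal, leaving `g([Z, X], [Z, X]) = 0`; a null tangent vector
  -- is a multiple of `K`.
  have h2 := mvfderiv_eq_zero_of_tangent (h.mdifferentiableAt p)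
    (g.mdifferentiableAt_apply ⁅Z, X⁆ X (ι p)) (Filter.Eventually.of_forall h1) (hinv Z hZ p)
  have h3 := hZ ⁅Z, X⁆ X (ι p)
  rw [h2, (g.isLorentz (ι p)).1 _ (X (ι p)), hXv p _ (hinv _ hZZX p), zero_add] at h3
  exact h3.symm

/-- The ideal of the Killing vector fields that are multiples of the generator along the horizon. -/
def nullIdeal (h : IsGenerator (E' := E') g ι K) (hinv : IsKillingInvariant (E' := E') g ι) :
    LieIdeal ℝ (killingAlgebra g) where
  carrier := {X | ∀ p, ∃ c : ℝ, (X : VField E M) (ι p) = c • K (ι p)}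
  zero_mem' := fun p => ⟨0, (zero_smul ℝ _).symm⟩
  add_mem' := by
    intro X Y hX hY p
    obtain ⟨c, hc⟩ := hX p
    obtain ⟨d, hd⟩ := hY p
    refine ⟨c + d, ?_⟩
    rw [add_smul, ← hc, ← hd]
    rfl
  smul_mem' := by
    intro r X hX p
    obtain ⟨c, hc⟩ := hX p
    refine ⟨r * c, ?_⟩
    rw [mul_smul, ← hc]
    rfl
  lie_mem := fun {Z X} hX p => h.exists_lie_eq_smul hinv X.2 hX Z.2 p

/-- A Killing vector field that vanishes on a hypersurface is zero. -/
theorem IsKilling.eq_zero_of_vanish_on_hypersurface [T2Space M] [ConnectedSpace M] {X : VField E M}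
    (hX : IsKilling g X) (h : IsHypersurface (E := E) (E' := E') ι) (h0 : ∀ p, X (ι p) = 0) (p : N) :
    X = 0 := by
  refine hX.eq_zero (h0 p) ?_
  have hι : MDifferentiableAt 𝓘(ℝ, E') 𝓘(ℝ, E) ι p := (h.contMDiff p).mdifferentiableAt (by simp)
  have : FiniteDimensional ℝ (TangentSpace 𝓘(ℝ, E) (ι p)) := inferInstanceAs (FiniteDimensional ℝ E)
  ext u
  refine (g.isLorentz (ι p)).eq_zero_of_skew (h.finrank_tangent p)
    (A := (X.coordDeriv (ι p)).toLinearMap) ?_ ?_ u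
  · intro v w
    obtain ⟨V, rfl⟩ := exists_apply_eq (ι p) v
    obtain ⟨W, rfl⟩ := exists_apply_eq (ι p) w
    have := hX.skew_of_eq_zero (h0 p) V W
    rwa [lie_apply_of_eq_zero V (h0 p), lie_apply_of_eq_zero W (h0 p)] at this
  · intro v hv
    refine mvfderiv_eq_zero_of_tangent hι (coord_mdiff X (ι p)) ?_ hv
    filter_upwards [hι.continuousAt.eventually (eventually_mem_chart_source (E := E) (ι p))] with q hq
    exact (X.coord_eq_zero_iff hq).2 (h0 q)

/-- The surface gravity equation: `[K, [K, X]] = κ [K, X]` along the horizon, for the Killing vector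
fields `X` that are multiples of `K` along the horizon. -/
theorem IsGenerator.exists_lie_lie_eq_smul [T2Space M] (h : IsGenerator (E' := E') g ι K)
    (hinv : IsKillingInvariant (E' := E') g ι) (p : N) :
    ∃ κ : ℝ, ∀ X ∈ nullIdeal h hinv,
      ⁅K, ⁅K, (X : VField E M)⁆⁆ (ι p) = κ • ⁅K, (X : VField E M)⁆ (ι p) := by
  have : FiniteDimensional ℝ (TangentSpace 𝓘(ℝ, E) (ι p)) := inferInstanceAs (FiniteDimensional ℝ E)
  obtain ⟨κ, hκ⟩ := KillingHorizons.exists_lie_lie_eq_smul h.isKilling (h.ne_zero p) (fun v w =>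
    mul_eq_mul_of_vanish_on_hyperplane (h.isHypersurface.finrank_tangent p)
      (α := (mvfderiv 𝓘(ℝ, E) (fun b => g.toFun b (K b) (K b)) (ι p)).toLinearMap)
      (β := (g.toFun (ι p) (K (ι p))).toLinearMap)
      (fun v hv => mvfderiv_eq_zero_of_tangent (h.mdifferentiableAt p)
        (g.mdifferentiableAt_apply K K (ι p)) (Filter.Eventually.of_forall h.null) hv)
      (h.orthogonal p) v w)
  refine ⟨κ, fun X hX => hκ X X.2 (hX p) ?_ ?_⟩
  · exact (nullIdeal h hinv).lie_mem (x := ⟨K, h.isKilling⟩) hX p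
  · exact (nullIdeal h hinv).lie_mem (x := ⟨K, h.isKilling⟩)
      ((nullIdeal h hinv).lie_mem (x := ⟨K, h.isKilling⟩) hX) p

/-- On `[J, J]`, `ad K` acts at `p` as multiplication by `κ p`, by the Leibniz rule and the surface
gravity equation. For `X = xK` and `Y = yK` in `[J, J]` this gives `[X, Y] = x κ y K - y κ x K = 0`
along `H`. The value of `κ` may vary with `p`, and only vanishing on all of `H` forces `[X, Y] = 0`.
-/
theorem derivedSeries_nullIdeal_eq_bot [T2Space M] [ConnectedSpace M]
    (h : IsGenerator (E' := E') g ι K) (hinv : IsKillingInvariant (E' := E') g ι) (p₀ : N) :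
    LieAlgebra.derivedSeriesOfIdeal ℝ (killingAlgebra g) 2 (nullIdeal h hinv) = ⊥ := by
  choose κ hκ using h.exists_lie_lie_eq_smul hinv
  set J := nullIdeal h hinv with hJ
  let K₀ : killingAlgebra g := ⟨K, h.isKilling⟩
  have hle : ∀ W ∈ (⁅J, J⁆ : LieIdeal ℝ (killingAlgebra g)), ∀ p,
      ⁅K, (W : VField E M)⁆ (ι p) = κ p • (W : VField E M) (ι p) := by
    intro W hW p
    -- The eigenvalue equation at `p` is the kernel of a linear map, so it suffices to check it on
    -- brackets, which span `[J, J]`.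
    let Φ : killingAlgebra g →ₗ[ℝ] TangentSpace 𝓘(ℝ, E) (ι p) :=
      VField.evalAt (ι p) ∘ₗ ((killingAlgebra g).incl : killingAlgebra g →ₗ[ℝ] VField E M) ∘ₗ
        (LieAlgebra.ad ℝ (killingAlgebra g) K₀ - κ p • LinearMap.id)
    have hΦ : ∀ W : killingAlgebra g,
        Φ W = ⁅K, (W : VField E M)⁆ (ι p) - κ p • (W : VField E M) (ι p) := fun W => rfl
    have hker : (⁅J, J⁆ : LieIdeal ℝ (killingAlgebra g)).toSubmodule ≤ LinearMap.ker Φ := by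
      rw [LieSubmodule.lieIdeal_oper_eq_linear_span', Submodule.span_le]
      rintro _ ⟨X, hX, Y, hY, rfl⟩
      obtain ⟨x, hx⟩ := hX p
      obtain ⟨y, hy⟩ := hY p
      obtain ⟨x', hx'⟩ := J.lie_mem (x := K₀) hX p
      obtain ⟨y', hy'⟩ := J.lie_mem (x := K₀) hY p
      change ⁅K, (X : VField E M)⁆ (ι p) = _ at hx'
      change ⁅K, (Y : VField E M)⁆ (ι p) = _ at hy'
      have e1 := lie_apply_of_eq_smul hx hy
      have e2 := lie_apply_of_eq_smul hx' hy
      have e3 := lie_apply_of_eq_smul hx hy'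
      have e4 : ⁅K, ⁅(X : VField E M), (Y : VField E M)⁆⁆ (ι p) =
          ⁅⁅K, (X : VField E M)⁆, (Y : VField E M)⁆ (ι p) +
            ⁅(X : VField E M), ⁅K, (Y : VField E M)⁆⁆ (ι p) :=
        congrArg (fun W : VField E M => W (ι p)) (leibniz_lie K (X : VField E M) (Y : VField E M))
      rw [SetLike.mem_coe, LinearMap.mem_ker, hΦ]
      change ⁅K, ⁅(X : VField E M), (Y : VField E M)⁆⁆ (ι p) -
        κ p • ⁅(X : VField E M), (Y : VField E M)⁆ (ι p) = 0
      rw [e4, e1, e2, e3, hκ p X hX, hκ p Y hY, hx', hy']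
      module
    have := hker hW
    rw [LinearMap.mem_ker, hΦ] at this
    exact sub_eq_zero.1 this
  have hJJ : (⁅J, J⁆ : LieIdeal ℝ (killingAlgebra g)) ≤ J := LieSubmodule.lie_le_left J J
  rw [LieAlgebra.derivedSeriesOfIdeal_succ, LieAlgebra.derivedSeriesOfIdeal_succ,
    LieAlgebra.derivedSeriesOfIdeal_zero, LieSubmodule.lie_eq_bot_iff]
  intro X hX Y hY
  refine Subtype.ext (IsKilling.eq_zero_of_vanish_on_hypersurface (E' := E') ⁅X, Y⁆.2
    h.isHypersurface (fun p => ?_) p₀)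
  obtain ⟨x, hx⟩ := hJJ hX p
  obtain ⟨y, hy⟩ := hJJ hY p
  change ⁅(X : VField E M), (Y : VField E M)⁆ (ι p) = 0
  rw [lie_apply_of_eq_smul hx hy, hle X hX p, hle Y hY p, hx, hy]
  module

/-- The Gram determinant of a basis of `𝔞(𝔯)` vanishes on invariant Killing horizons. -/
theorem metricWedgeNormSq_eq_zero [T2Space M] [ConnectedSpace M] {r : ℕ}
    (b : Module.Basis (Fin r) ℝ (radicalAbelianIdeal (killingAlgebra g))) (K : Fin r → VField E M)
    (hK : ∀ i, K i = ((b i : killingAlgebra g) : VField E M))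
    (hH : IsKillingHorizon (E' := E') g ι) (hinv : IsKillingInvariant (E' := E') g ι) (p : N) :
    metricWedgeNormSq g K (ι p) = 0 := by
  obtain ⟨K₀, h⟩ := hH.exists_isGenerator
  have hne : nullIdeal h hinv ≠ ⊥ := by
    intro h0
    have hmem : (⟨K₀, h.isKilling⟩ : killingAlgebra g) ∈ nullIdeal h hinv :=
      fun p => ⟨1, (one_smul ℝ _).symm⟩
    rw [h0, LieSubmodule.mem_bot] at hmem
    refine h.ne_zero p ?_
    rw [show K₀ = 0 from congrArg Subtype.val hmem]
    rfl
  obtain ⟨Y, hYJ, hY0, hYa⟩ := exists_ne_zero_mem_radicalAbelianIdeal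
    (derivedSeries_nullIdeal_eq_bot h hinv p) hne
  let Y' : radicalAbelianIdeal (killingAlgebra g) := ⟨Y, hYa⟩
  have hc : b.repr Y' ≠ 0 := fun h0 => hY0 (congrArg Subtype.val (b.repr.map_eq_zero_iff.1 h0))
  have hsum : (Y : VField E M) = ∑ i, b.repr Y' i • K i := coe_eq_sum_repr b hK Y'
  rw [metricWedgeNormSq_eq_det, ← Matrix.exists_mulVec_eq_zero_iff]
  -- The coordinates of `Y` form the kernel vector: `Y` is normal to `H`, and all `K i` are tangent
  -- by invariance.
  refine ⟨b.repr Y', fun h0 => hc (DFunLike.ext' h0), funext fun i => ?_⟩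
  have hYi : g.toFun (ι p) ((Y : VField E M) (ι p)) (K i (ι p)) = 0 := by
    obtain ⟨c, hc⟩ := hYJ p
    rw [hc, map_smul, smul_apply, h.orthogonal p _ (hinv _ (by rw [hK]; exact (b i).1.2) p), smul_zero]
  rw [hsum, VField.sum_smul_apply, map_sum, sum_apply] at hYi
  simp only [Matrix.mulVec, dotProduct, Matrix.of_apply, Pi.zero_apply]
  rw [← hYi]
  refine Finset.sum_congr rfl fun j _ => ?_
  rw [map_smul, smul_apply, smul_eq_mul, mul_comm]

end Horizon

end KillingHorizons

/-! ### The action of `𝔤` on `𝔞(𝔯)` and its trace. -/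

namespace KillingHorizons

open Bundle Set VectorField
open scoped Manifold ContDiff Topology

set_option linter.unusedSectionVars false

variable {E : Type*} [NormedAddCommGroup E] [NormedSpace ℝ E] [FiniteDimensional ℝ E]
  {M : Type*} [TopologicalSpace M] [ChartedSpace E M] [IsManifold 𝓘(ℝ, E) ∞ M]

section Normalizer

variable {g : LorentzMetric E M}

/-- The derivation of the Killing algebra defined by a vector field that normalizes it. -/
noncomputable def normalizerDerivation (X : VField E M)
    (hX : ∀ K ∈ killingAlgebra g, ⁅X, K⁆ ∈ killingAlgebra g) :
    LieDerivation ℝ (killingAlgebra g) (killingAlgebra g) where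
  toFun K := ⟨⁅X, (K : VField E M)⁆, hX K K.2⟩
  map_add' K L := Subtype.ext (lie_add X (K : VField E M) (L : VField E M))
  map_smul' c K := Subtype.ext (lie_smul c X (K : VField E M))
  leibniz' K L := Subtype.ext (by
    change ⁅X, ⁅(K : VField E M), (L : VField E M)⁆⁆ =
      ⁅(K : VField E M), ⁅X, (L : VField E M)⁆⁆ - ⁅(L : VField E M), ⁅X, (K : VField E M)⁆⁆
    rw [leibniz_lie, ← lie_skew ⁅X, (K : VField E M)⁆ (L : VField E M)]
    abel)

variable {𝔤 : LieSubalgebra ℝ (VField E M)}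
  (hideal : ∀ X ∈ 𝔤, ∀ K ∈ killingAlgebra g, ⁅X, K⁆ ∈ killingAlgebra g)

/-- The adjoint action on `𝔞(𝔯)` of a Lie algebra that contains the Killing algebra as an ideal. -/
noncomputable def radicalAction (K : radicalAbelianIdeal (killingAlgebra g)) :
    𝔤 →ₗ[ℝ] radicalAbelianIdeal (killingAlgebra g) where
  toFun X := ⟨normalizerDerivation (X : VField E M) (hideal X X.2) K,
    derivation_mem_radicalAbelianIdeal _ K.2⟩
  map_add' X Y := Subtype.ext (Subtype.ext (add_lie (X : VField E M) (Y : VField E M) (K : VField E M)))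
  map_smul' c X := Subtype.ext (Subtype.ext (smul_lie c (X : VField E M) (K : VField E M)))

variable {r : ℕ} (b : Module.Basis (Fin r) ℝ (radicalAbelianIdeal (killingAlgebra g)))

/-- The matrix of the adjoint action on `𝔞(𝔯)`. -/
noncomputable def radicalActionMatrix (X : 𝔤) : Matrix (Fin r) (Fin r) ℝ :=
  Matrix.of fun i k => b.repr (radicalAction hideal (b i) X) k

theorem lie_eq_sum_radicalActionMatrix {K : Fin r → VField E M}
    (hK : ∀ i, K i = ((b i : killingAlgebra g) : VField E M)) (X : 𝔤) (i : Fin r) :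
    ⁅(X : VField E M), K i⁆ = ∑ k, radicalActionMatrix hideal b X i k • K k := by
  rw [hK i]
  exact coe_eq_sum_repr b hK (radicalAction hideal (b i) X)

/-- The trace of the adjoint action on `𝔞(𝔯)`. -/
noncomputable def radicalWeight : 𝔤 →ₗ[ℝ] ℝ :=
  ∑ i, (b.coord i) ∘ₗ radicalAction hideal (b i)

theorem radicalWeight_apply (X : 𝔤) :
    radicalWeight hideal b X = (radicalActionMatrix hideal b X).trace := by
  rw [radicalWeight, LinearMap.sum_apply]
  rfl

end Normalizer

end KillingHorizons

open KillingHorizons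
open scoped Manifold ContDiff
theorem theorem2
    {E : Type*} [NormedAddCommGroup E] [NormedSpace ℝ E] [FiniteDimensional ℝ E]
    {M : Type*} [TopologicalSpace M] [ChartedSpace E M] [IsManifold 𝓘(ℝ, E) ∞ M]
    [T2Space M] [SecondCountableTopology M] [ConnectedSpace M]
    (g : LorentzMetric E M)
    (𝔤 : LieSubalgebra ℝ (VField E M)) (h𝔨𝔤 : killingAlgebra g ≤ 𝔤)
    (hideal : ∀ X ∈ 𝔤, ∀ K ∈ killingAlgebra g, ⁅X, K⁆ ∈ killingAlgebra g)
    {r : ℕ} (b : Module.Basis (Fin r) ℝ (radicalAbelianIdeal (killingAlgebra g)))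
    (K : Fin r → VField E M) (hK : ∀ i, K i = ((b i : killingAlgebra g) : VField E M)) :
    -- the ideal spanned by the `K i` is abelian, and an ideal of `𝔤`
    (∀ i j, ⁅K i, K j⁆ = 0) ∧
    (∀ X ∈ 𝔤, ∀ i, ⁅X, K i⁆ ∈ Submodule.span ℝ (Set.range K)) ∧
    -- vanishing on invariant Killing horizons
    (∀ (E' : Type*) [NormedAddCommGroup E'] [NormedSpace ℝ E'] [FiniteDimensional ℝ E']
      (N : Type*) [TopologicalSpace N] [ChartedSpace E' N] [IsManifold 𝓘(ℝ, E') ∞ N]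
      (ι : N → M), IsKillingHorizon (E' := E') g ι → IsKillingInvariant (E' := E') g ι →
      ∀ p, metricWedgeNormSq g K (ι p) = 0) ∧
    -- restriction of a relative invariant
    (∃ wt : 𝔤 →ₗ[ℝ] ℝ,
      (∀ (X : 𝔤) (a : M), lieWedgeAt (X : VField E M) K a = wt X • wedgeAt K a) ∧
      IsRelativeInvariantOn 𝔤 (lorentzBundle E M) (wedgeInvariant K) ((2 : ℝ) • wt)) ∧
    (∀ a, metricWedgeNormSq g K a = wedgeInvariant K (g.toSection a)) := by
  have hC := lie_eq_sum_radicalActionMatrix hideal b hK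
  refine ⟨fun i j => ?_, fun X hX i => ?_, ?_, ⟨radicalWeight hideal b, fun X a => ?_, ?_⟩, fun a => ?_⟩
  · rw [hK, hK]
    exact congrArg Subtype.val (lie_radicalAbelianIdeal_eq_zero (b i).2 (b j).2)
  · rw [hC ⟨X, hX⟩ i]
    exact Submodule.sum_mem _ fun k _ =>
      Submodule.smul_mem _ _ (Submodule.subset_span (Set.mem_range_self k))
  · intro E' _ _ _ N _ _ _ ι hH hinv p
    exact metricWedgeNormSq_eq_zero b K hK hH hinv p
  · rw [radicalWeight_apply]
    exact lieWedgeAt_eq K X _ (hC X) a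
  · refine fun θ _ => ⟨contMDiff_wedgeInvariant K θ, fun X => ?_⟩
    rw [mvfderiv_wedgeInvariant K X _ (hC X), LinearMap.smul_apply, radicalWeight_apply, smul_eq_mul]
  · rw [metricWedgeNormSq_eq_det, wedgeInvariant_eq_det]
    rfl
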